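/- Let $R$ be a commutative ring with $1$, let $\ast:R\to R$ be an automorphism with $r^{\ast\ast}=r$ for all $r$, let $\sigma:R\to R$ be an automorphism commuting with $\ast$, and let $t\in R$ satisfy $t^\ast=t$. Let $A=R(\sigma,t)$ be the generalized Weyl algebra, i.e. the ring generated by $R$ and two symbols $X,Y$ with the relations that $R$ is a subring and $YX=t$, $XY=\sigma(t)$, $Xr=\sigma(r)X$, $Yr=\sigma^{-1}(r)Y$ for $r\in R$. It is $\mathbb Z$-graded, $A=\bigoplus_n A_n$, with $\deg X=1$, $\deg Y=-1$, $\deg r=0$, and carries the involution extending $\ast$ with $X^\ast=Y$, $Y^\ast=X$. For an $A$-module $V$ and a maximal ideal $\mathfrak m$ of $R$ put $V_{\mathfrak m}=\{v\in V:\mathfrak m v=0\}$; $V$ is a weight module if $V=\bigoplus_{\mathfrak m}V_{\mathfrak m}$, and its support is $\{\mathfrak m: V_{\mathfrak m}\ne 0\}$. For an orbit $\omega$ of $\sigma$ on the set of maximal ideals of $R$ put $R_\omega=\bigoplus_{\mathfrak m\in\omega}R/\mathfrak m$, and let $\sigma:R_\omega\to R_\omega$ be the map induced by the isomorphisms $R/\mathfrak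 m\to R/\sigma(\mathfrak m)$. Let $V$ be a weight $A$-module with support in $\omega$. * $V$ is pseudo-unitarizable if there is a biadditive map $F:V\times V\to R_\omega$ with $F(rv,w)=rF(v,w)$ for $r\in R$ and $F(av,w)=\sigma^{n}(F(v,a^\ast w))$ for $a\in A_n$, $n\in\mathbb Z$, which is non-degenerate: for every nonzero $v\in V$ there are $w_1,w_2\in V$ with $F(w_1,v)\neq0\neq F(v,w_2)$. * The finitistic dual $V^\sharp$ is the set of additive maps $\varphi:V\to R_\omega$ with $\varphi(rv)=r^\ast\varphi(v)$ for $r\in R$ and with $\varphi(V_{\mathfrak m})=0$ for all but finitely many $\mathfrak m\in\omega$. It is an $A$-module via $(r\varphi)(v)=r\varphi(v)$, $(X\varphi)(v)=\sigma(\varphi(Yv))$, $(Y\varphi)(v)=\sigma^{-1}(\varphi(Xv))$. Let $\omega$ be a finite orbit, and let $m$ be the number of breaks of $\omega$, i.e. of $\mathfrak m\in\omega$ with $t\in\mathfrak m$. Assume $m>0$, and that $\omega$ is real, i.e. $\mathfrak m^\ast=\mathfrak m$ for all $\mathfrak m\in\omega$. Fix a break $\mathfrak m_0\in\omega$ and label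 the breaks $\mathfrak m_0,\mathfrak m_1,\dots,\mathfrak m_{m-1}$ (indices in $\mathbb Z_m=\mathbb Z/m\mathbb Z$) in the cyclic order in which they are met along $\mathfrak m_0,\sigma(\mathfrak m_0),\sigma^2(\mathfrak m_0),\dots$. For $\mathfrak m\in\omega$ let $j(\mathfrak m)\in\mathbb Z_m$ be the index of the first break among $\mathfrak m,\sigma(\mathfrak m),\sigma^2(\mathfrak m),\dots$. Let $w=z_1z_2\cdots z_n$ $(n\ge0)$ be a word in the letters $x,y$, and let $w^\sharp$ be the word obtained from $w$ by exchanging $x$ and $y$. For $j\in\mathbb Z_m$ let $V(\omega,j,w)=\bigoplus_{\mathfrak m\in\omega}V_{\mathfrak m}$, where $V_{\mathfrak m}$ is the $R/\mathfrak m$-vector space with basis the pairs $[\mathfrak m,e_k]$, $0\le k\le n$, with $j+k=j(\mathfrak m)$ in $\mathbb Z_m$, and where for $\lambda\in R/\mathfrak m$ $$X\lambda[\mathfrak m,e_k]=\begin{cases}\sigma(\lambda)\,\sigma(t+\mathfrak m)\,[\sigma(\mathfrak m),e_k]&\text{if }t\notin\mathfrak m,\\ \sigma(\lambda)\,[\sigma(\mathfrak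 m),e_{k+1}]&\text{if }t\in\mathfrak m,\ k<n,\ z_{k+1}=x,\\ 0&\text{otherwise,}\end{cases}$$ $$Y\lambda[\mathfrak m,e_k]=\begin{cases}\sigma^{-1}(\lambda)\,[\sigma^{-1}(\mathfrak m),e_k]&\text{if }t\notin\sigma^{-1}(\mathfrak m),\\ \sigma^{-1}(\lambda)\,[\sigma^{-1}(\mathfrak m),e_{k-1}]&\text{if }t\in\sigma^{-1}(\mathfrak m),\ k\ge1,\ z_k=y,\\ 0&\text{otherwise.}\end{cases}$$ **Theorem.** For every $j\in\mathbb Z_m$ and every word $w$ there is an isomorphism of $A$-modules $V(\omega,j,w)^\sharp\cong V(\omega,j,w^\sharp)$. Moreover, $V(\omega,j,w)$ is pseudo-unitarizable if and only if $w$ is the empty word, and $w$ is the empty word if and only if $V(\omega,j,w)$ is a simple $A$-module. -/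

import Mathlib

noncomputable section

open scoped DirectSum Classical

universe u v

/-- The data defining a generalized Weyl algebra of rank one with involution: over a commutative
ring `R` with an involutive automorphism `star`, an automorphism `σ` commuting with `star` and a
selfadjoint element `t`. -/
structure GWAData (R : Type u) [CommRing R] [StarRing R] where
  σ : R ≃+* R
  t : R
  σ_star : ∀ r, σ (star r) = star (σ r)
  t_star : star t = t

namespace GWAData

/-- The generators `R ∪ {X, Y}`. -/
inductive Gen (R : Type u) : Type u
  | coe (r : R) : Gen R
  | X : Gen R
  | Y : Gen R

variable {R : Type u} [CommRing R] [StarRing R] (D : GWAData R)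

/-! ### The generalized Weyl algebra -/

/-- The defining relations: those which make `R` map to the algebra as a unital ring, and
`YX = t`, `XY = σ(t)`, `Xr = σ(r)X`, `Yr = σ⁻¹(r)Y`. -/
inductive Rel : FreeAlgebra ℤ (Gen R) → FreeAlgebra ℤ (Gen R) → Prop
  | coe_one : Rel (FreeAlgebra.ι ℤ (Gen.coe 1)) 1
  | coe_add (r s : R) : Rel (FreeAlgebra.ι ℤ (Gen.coe (r + s)))
      (FreeAlgebra.ι ℤ (Gen.coe r) + FreeAlgebra.ι ℤ (Gen.coe s))
  | coe_mul (r s : R) : Rel (FreeAlgebra.ι ℤ (Gen.coe (r * s)))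
      (FreeAlgebra.ι ℤ (Gen.coe r) * FreeAlgebra.ι ℤ (Gen.coe s))
  | Y_mul_X : Rel (FreeAlgebra.ι ℤ Gen.Y * FreeAlgebra.ι ℤ Gen.X)
      (FreeAlgebra.ι ℤ (Gen.coe D.t))
  | X_mul_Y : Rel (FreeAlgebra.ι ℤ Gen.X * FreeAlgebra.ι ℤ Gen.Y)
      (FreeAlgebra.ι ℤ (Gen.coe (D.σ D.t)))
  | X_mul_coe (r : R) : Rel (FreeAlgebra.ι ℤ Gen.X * FreeAlgebra.ι ℤ (Gen.coe r))
      (FreeAlgebra.ι ℤ (Gen.coe (D.σ r)) * FreeAlgebra.ι ℤ Gen.X)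
  | Y_mul_coe (r : R) : Rel (FreeAlgebra.ι ℤ Gen.Y * FreeAlgebra.ι ℤ (Gen.coe r))
      (FreeAlgebra.ι ℤ (Gen.coe (D.σ.symm r)) * FreeAlgebra.ι ℤ Gen.Y)

/-- The generalized Weyl algebra `A = R(σ, t)`. -/
def Alg : Type u := RingQuot D.Rel

instance : Ring D.Alg := inferInstanceAs (Ring (RingQuot D.Rel))

/-- The canonical projection from the free ring on `R ∪ {X, Y}`. -/
def proj : FreeAlgebra ℤ (Gen R) →+* D.Alg := RingQuot.mkRingHom D.Rel

theorem proj_rel {a b : FreeAlgebra ℤ (Gen R)} (h : D.Rel a b) : D.proj a = D.proj b :=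
  RingQuot.mkRingHom_rel h

/-- The canonical map `R → A`. -/
def ofR : R →+* D.Alg where
  toFun r := D.proj (FreeAlgebra.ι ℤ (Gen.coe r))
  map_one' := by rw [D.proj_rel Rel.coe_one, map_one]
  map_mul' r s := by rw [D.proj_rel (Rel.coe_mul r s), map_mul]
  map_add' r s := by rw [D.proj_rel (Rel.coe_add r s), map_add]
  map_zero' := by
    have h := D.proj_rel (Rel.coe_add (D := D) 0 0)
    rw [add_zero, map_add] at h
    simpa using h

/-- The generator `X` of `A`. -/
def X : D.Alg := D.proj (FreeAlgebra.ι ℤ Gen.X)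

/-- The generator `Y` of `A`. -/
def Y : D.Alg := D.proj (FreeAlgebra.ι ℤ Gen.Y)

theorem Y_mul_X : D.Y * D.X = D.ofR D.t := by
  have h := D.proj_rel Rel.Y_mul_X
  rw [map_mul] at h
  exact h

theorem X_mul_Y : D.X * D.Y = D.ofR (D.σ D.t) := by
  have h := D.proj_rel Rel.X_mul_Y
  rw [map_mul] at h
  exact h

theorem X_mul_ofR (r : R) : D.X * D.ofR r = D.ofR (D.σ r) * D.X := by
  have h := D.proj_rel (Rel.X_mul_coe r)
  rw [map_mul, map_mul] at h
  exact h

theorem Y_mul_ofR (r : R) : D.Y * D.ofR r = D.ofR (D.σ.symm r) * D.Y := by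
  have h := D.proj_rel (Rel.Y_mul_coe r)
  rw [map_mul, map_mul] at h
  exact h

/-- The universal property of `A`. -/
def lift {S : Type*} [Ring S] (f : R →+* S) (x y : S) (hyx : y * x = f D.t)
    (hxy : x * y = f (D.σ D.t)) (hx : ∀ r, x * f r = f (D.σ r) * x)
    (hy : ∀ r, y * f r = f (D.σ.symm r) * y) : D.Alg →+* S :=
  RingQuot.lift ⟨(FreeAlgebra.lift ℤ (fun g : Gen R =>
      match g with
      | Gen.coe r => f r
      | Gen.X => x
      | Gen.Y => y) : FreeAlgebra ℤ (Gen R) →ₐ[ℤ] S).toRingHom, by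
    intro a b h
    cases h <;> simp [hyx, hxy, hx, hy]⟩

section lift

variable {S : Type*} [Ring S] (f : R →+* S) (x y : S) (hyx : y * x = f D.t)
    (hxy : x * y = f (D.σ D.t)) (hx : ∀ r, x * f r = f (D.σ r) * x)
    (hy : ∀ r, y * f r = f (D.σ.symm r) * y)

@[simp] theorem lift_ofR (r : R) : D.lift f x y hyx hxy hx hy (D.ofR r) = f r := by
  refine (RingQuot.lift_mkRingHom_apply _ _ _).trans ?_
  simp

@[simp] theorem lift_X : D.lift f x y hyx hxy hx hy D.X = x := by
  refine (RingQuot.lift_mkRingHom_apply _ _ _).trans ?_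
  simp

@[simp] theorem lift_Y : D.lift f x y hyx hxy hx hy D.Y = y := by
  refine (RingQuot.lift_mkRingHom_apply _ _ _).trans ?_
  simp

end lift

/-- Two ring homomorphisms on `A` agree if they agree on `R`, `X` and `Y`. -/
theorem hom_ext {S : Type*} [Ring S] {f g : D.Alg →+* S} (h : ∀ r, f (D.ofR r) = g (D.ofR r))
    (hX : f D.X = g D.X) (hY : f D.Y = g D.Y) : f = g := by
  apply RingQuot.ringQuot_ext
  have key : ((f.comp D.proj).toIntAlgHom : FreeAlgebra ℤ (Gen R) →ₐ[ℤ] S)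
      = (g.comp D.proj).toIntAlgHom := by
    apply FreeAlgebra.hom_ext
    funext a
    cases a with
    | coe r => exact h r
    | X => exact hX
    | Y => exact hY
  exact RingHom.ext fun a => DFunLike.congr_fun key a

/-- The ring homomorphism `A → Aᵒᵖ` underlying the involution of `A`. -/
def starHom : D.Alg →+* D.Algᵐᵒᵖ :=
  D.lift ((D.ofR.comp (starRingEnd R)).toOpposite fun _ _ => by
      rw [commute_iff_eq, ← map_mul, ← map_mul, mul_comm])
    (MulOpposite.op D.Y) (MulOpposite.op D.X)
    (by
      rw [← MulOpposite.op_mul, D.Y_mul_X]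
      simp [RingHom.toOpposite, starRingEnd_apply, D.t_star])
    (by
      rw [← MulOpposite.op_mul, D.X_mul_Y]
      simp [RingHom.toOpposite, starRingEnd_apply, ← D.σ_star, D.t_star])
    (by
      intro r
      show MulOpposite.op D.Y * MulOpposite.op (D.ofR (star r))
        = MulOpposite.op (D.ofR (star (D.σ r))) * MulOpposite.op D.Y
      rw [← MulOpposite.op_mul, ← MulOpposite.op_mul, D.Y_mul_ofR, ← D.σ_star,
        RingEquiv.symm_apply_apply])
    (by
      intro r
      show MulOpposite.op D.X * MulOpposite.op (D.ofR (star r))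
        = MulOpposite.op (D.ofR (star (D.σ.symm r))) * MulOpposite.op D.X
      rw [← MulOpposite.op_mul, ← MulOpposite.op_mul, D.X_mul_ofR, D.σ_star,
        RingEquiv.apply_symm_apply])

/-- The involution of `A` extending that of `R`, with `X* = Y` and `Y* = X`. -/
instance : StarRing D.Alg where
  star a := (D.starHom a).unop
  star_involutive := by
    have h : (RingEquiv.opOp D.Alg).symm.toRingHom.comp
        ((RingHom.op D.starHom).comp D.starHom) = RingHom.id D.Alg := by
      apply D.hom_ext
      · intro r
        simp [starHom, RingHom.toOpposite, starRingEnd_apply]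
      · simp [starHom]
      · simp [starHom]
    intro a
    exact DFunLike.congr_fun h a
  star_mul a b := by simp
  star_add a b := by simp

theorem star_ofR (r : R) : star (D.ofR r) = D.ofR (star r) := by
  show (D.starHom (D.ofR r)).unop = _
  simp [starHom, RingHom.toOpposite, starRingEnd_apply]

theorem star_X : star D.X = D.Y := by
  show (D.starHom D.X).unop = _
  simp [starHom]

theorem star_Y : star D.Y = D.X := by
  show (D.starHom D.Y).unop = _
  simp [starHom]

/-- `D.IsHomogeneous n a` says that `a` lies in the component `A_n` of the `ℤ`-grading of `A` with
`deg X = 1`, `deg Y = -1` and `deg r = 0` for `r ∈ R`. -/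
inductive IsHomogeneous : ℤ → D.Alg → Prop
  | ofR (r : R) : IsHomogeneous 0 (D.ofR r)
  | X : IsHomogeneous 1 D.X
  | Y : IsHomogeneous (-1) D.Y
  | mul {m n : ℤ} {a b : D.Alg} :
      IsHomogeneous m a → IsHomogeneous n b → IsHomogeneous (m + n) (a * b)
  | add {n : ℤ} {a b : D.Alg} :
      IsHomogeneous n a → IsHomogeneous n b → IsHomogeneous n (a + b)

/-! ### Orbits of maximal ideals -/

/-- The action of `σ` on the set of maximal ideals of `R`, `𝔪 ↦ σ(𝔪)`. -/
def σMax : Equiv.Perm (MaximalSpectrum R) where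
  toFun m := ⟨m.asIdeal.comap D.σ.symm, Ideal.comap_isMaximal_of_equiv D.σ.symm⟩
  invFun m := ⟨m.asIdeal.comap D.σ, Ideal.comap_isMaximal_of_equiv D.σ⟩
  left_inv m := MaximalSpectrum.ext <| Ideal.ext fun r => by simp [Ideal.mem_comap]
  right_inv m := MaximalSpectrum.ext <| Ideal.ext fun r => by
    rw [Ideal.mem_comap, Ideal.mem_comap, RingEquiv.apply_symm_apply]

theorem mem_σMax {m : MaximalSpectrum R} {r : R} :
    r ∈ (D.σMax m).asIdeal ↔ D.σ.symm r ∈ m.asIdeal := Iff.rfl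

theorem mem_σMax_symm {m : MaximalSpectrum R} {r : R} :
    r ∈ (D.σMax.symm m).asIdeal ↔ D.σ r ∈ m.asIdeal := Iff.rfl

/-- The orbits of `σ` on the set of maximal ideals of `R`. -/
structure Orbit where
  carrier : Set (MaximalSpectrum R)
  isOrbit : ∃ m₀, ∀ m, m ∈ carrier ↔ ∃ n : ℤ, (D.σMax ^ n) m₀ = m

variable {D}

namespace Orbit

theorem σMax_mem (ω : D.Orbit) {m : MaximalSpectrum R} (h : m ∈ ω.carrier) :
    D.σMax m ∈ ω.carrier := by
  obtain ⟨m₀, h₀⟩ := ω.isOrbit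
  obtain ⟨n, rfl⟩ := (h₀ m).1 h
  exact (h₀ _).2 ⟨1 + n, by rw [zpow_add, zpow_one, Equiv.Perm.mul_apply]⟩

theorem σMax_symm_mem (ω : D.Orbit) {m : MaximalSpectrum R} (h : m ∈ ω.carrier) :
    D.σMax.symm m ∈ ω.carrier := by
  obtain ⟨m₀, h₀⟩ := ω.isOrbit
  obtain ⟨n, rfl⟩ := (h₀ m).1 h
  exact (h₀ _).2 ⟨-1 + n, by rw [zpow_add, zpow_neg_one, Equiv.Perm.mul_apply]; rfl⟩

/-- `σ` as a map from an orbit to itself. -/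
def next (ω : D.Orbit) (m : ω.carrier) : ω.carrier := ⟨D.σMax m, ω.σMax_mem m.2⟩

/-- `σ⁻¹` as a map from an orbit to itself. -/
def prev (ω : D.Orbit) (m : ω.carrier) : ω.carrier := ⟨D.σMax.symm m, ω.σMax_symm_mem m.2⟩

theorem prev_next (ω : D.Orbit) (m : ω.carrier) : ω.prev (ω.next m) = m :=
  Subtype.ext (D.σMax.symm_apply_apply _)

theorem next_prev (ω : D.Orbit) (m : ω.carrier) : ω.next (ω.prev m) = m :=
  Subtype.ext (D.σMax.apply_symm_apply _)

/-- An orbit is real if `𝔪* = 𝔪` for all its members `𝔪`. -/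
def IsReal (ω : D.Orbit) : Prop :=
  ∀ m ∈ ω.carrier, ∀ r : R, star r ∈ m.asIdeal ↔ r ∈ m.asIdeal

/-- The set `B_ω` of breaks of the orbit: the members of `ω` that contain `t`. -/
def breaks (ω : D.Orbit) : Set (MaximalSpectrum R) := {m | m ∈ ω.carrier ∧ D.t ∈ m.asIdeal}

/-! ### The module `R_ω` -/

/-- The `R`-module `R_ω = ⨁_{𝔪 ∈ ω} R/𝔪`. -/
abbrev Rω (ω : D.Orbit) : Type u := ⨁ m : ω.carrier, R ⧸ (m : MaximalSpectrum R).asIdeal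

end Orbit

variable (D) in
/-- The map `R/𝔪 → R/σ(𝔪)` induced by `σ`. -/
def quotσ (m : MaximalSpectrum R) : R ⧸ m.asIdeal →+* R ⧸ (D.σMax m).asIdeal :=
  Ideal.quotientMap _ (D.σ : R →+* R) fun r hr => by
    rw [Ideal.mem_comap, mem_σMax]
    simpa using hr

variable (D) in
/-- The map `R/𝔪 → R/σ⁻¹(𝔪)` induced by `σ⁻¹`. -/
def quotσInv (m : MaximalSpectrum R) : R ⧸ m.asIdeal →+* R ⧸ (D.σMax.symm m).asIdeal :=
  Ideal.quotientMap _ (D.σ.symm : R →+* R) fun r hr => by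
    rw [Ideal.mem_comap, mem_σMax_symm]
    simpa using hr

namespace Orbit

theorem of_congr (ω : D.Orbit) {m n : ω.carrier} (h : m = n) (r : R) :
    (DirectSum.of (fun m : ω.carrier => R ⧸ (m : MaximalSpectrum R).asIdeal) m
        (Ideal.Quotient.mk _ r) : ω.Rω) =
      DirectSum.of (fun m : ω.carrier => R ⧸ (m : MaximalSpectrum R).asIdeal) n
        (Ideal.Quotient.mk _ r) := by
  subst h
  rfl

/-- The additive map `σ : R_ω → R_ω`. -/
def sigmaHom (ω : D.Orbit) : ω.Rω →+ ω.Rω :=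
  DirectSum.toAddMonoid fun m =>
    (DirectSum.of (fun m : ω.carrier => R ⧸ (m : MaximalSpectrum R).asIdeal) (ω.next m)).comp
      (D.quotσ m).toAddMonoidHom

/-- The additive map `σ⁻¹ : R_ω → R_ω`. -/
def sigmaInvHom (ω : D.Orbit) : ω.Rω →+ ω.Rω :=
  DirectSum.toAddMonoid fun m =>
    (DirectSum.of (fun m : ω.carrier => R ⧸ (m : MaximalSpectrum R).asIdeal) (ω.prev m)).comp
      (D.quotσInv m).toAddMonoidHom

theorem sigmaHom_of (ω : D.Orbit) (m : ω.carrier) (r : R) :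
    ω.sigmaHom (DirectSum.of _ m (Ideal.Quotient.mk _ r)) =
      DirectSum.of _ (ω.next m) (Ideal.Quotient.mk _ (D.σ r)) := by
  rw [sigmaHom, DirectSum.toAddMonoid_of]
  rfl

theorem sigmaInvHom_of (ω : D.Orbit) (m : ω.carrier) (r : R) :
    ω.sigmaInvHom (DirectSum.of _ m (Ideal.Quotient.mk _ r)) =
      DirectSum.of _ (ω.prev m) (Ideal.Quotient.mk _ (D.σ.symm r)) := by
  rw [sigmaInvHom, DirectSum.toAddMonoid_of]
  rfl

theorem Rω_hom_ext (ω : D.Orbit) {M : Type*} [AddMonoid M] {f g : ω.Rω →+ M}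
    (h : ∀ (m : ω.carrier) (r : R), f (DirectSum.of _ m (Ideal.Quotient.mk _ r)) =
      g (DirectSum.of _ m (Ideal.Quotient.mk _ r))) : f = g := by
  apply DirectSum.addHom_ext
  intro m x
  obtain ⟨r, rfl⟩ := Ideal.Quotient.mk_surjective x
  exact h m r

/-- The automorphism `σ` of the abelian group `R_ω`, induced by `σ : R/𝔪 → R/σ(𝔪)`. -/
def sigma (ω : D.Orbit) : ω.Rω ≃+ ω.Rω where
  toFun := ω.sigmaHom
  invFun := ω.sigmaInvHom
  left_inv := by
    have h : ω.sigmaInvHom.comp ω.sigmaHom = AddMonoidHom.id _ := by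
      apply ω.Rω_hom_ext
      intro m r
      rw [AddMonoidHom.comp_apply, sigmaHom_of, sigmaInvHom_of, RingEquiv.symm_apply_apply,
        ω.of_congr (ω.prev_next m)]
      rfl
    exact DFunLike.congr_fun h
  right_inv := by
    have h : ω.sigmaHom.comp ω.sigmaInvHom = AddMonoidHom.id _ := by
      apply ω.Rω_hom_ext
      intro m r
      rw [AddMonoidHom.comp_apply, sigmaInvHom_of, sigmaHom_of, RingEquiv.apply_symm_apply,
        ω.of_congr (ω.next_prev m)]
      rfl
    exact DFunLike.congr_fun h
  map_add' := map_add _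

theorem smul_of (ω : D.Orbit) (m : ω.carrier) (r s : R) :
    r • (DirectSum.of _ m (Ideal.Quotient.mk _ s) : ω.Rω) =
      DirectSum.of _ m (Ideal.Quotient.mk _ (r * s)) := by
  rw [← DirectSum.lof_eq_of R, ← map_smul, ← DirectSum.lof_eq_of R]
  rfl

theorem sigma_of (ω : D.Orbit) (m : ω.carrier) (r : R) :
    ω.sigma (DirectSum.of _ m (Ideal.Quotient.mk _ r)) =
      DirectSum.of _ (ω.next m) (Ideal.Quotient.mk _ (D.σ r)) := ω.sigmaHom_of m r

theorem sigma_symm_of (ω : D.Orbit) (m : ω.carrier) (r : R) :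
    ω.sigma.symm (DirectSum.of _ m (Ideal.Quotient.mk _ r)) =
      DirectSum.of _ (ω.prev m) (Ideal.Quotient.mk _ (D.σ.symm r)) := ω.sigmaInvHom_of m r

theorem sigma_smul (ω : D.Orbit) (r : R) (x : ω.Rω) :
    ω.sigma (r • x) = D.σ r • ω.sigma x := by
  have h : ω.sigma.toAddMonoidHom.comp (DistribSMul.toAddMonoidHom ω.Rω r) =
      (DistribSMul.toAddMonoidHom ω.Rω (D.σ r)).comp ω.sigma.toAddMonoidHom := by
    apply ω.Rω_hom_ext
    intro m s
    show ω.sigma (r • _) = D.σ r • ω.sigma _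
    rw [smul_of, sigma_of, sigma_of, smul_of, map_mul]
  exact DFunLike.congr_fun h x

theorem sigma_symm_smul (ω : D.Orbit) (r : R) (x : ω.Rω) :
    ω.sigma.symm (r • x) = D.σ.symm r • ω.sigma.symm x := by
  rw [AddEquiv.symm_apply_eq, sigma_smul, RingEquiv.apply_symm_apply, AddEquiv.apply_symm_apply]

end Orbit

/-! ### Weight modules, admissible forms and the finitistic dual -/

section modules

variable (D)
variable (V : Type v) [AddCommGroup V] [Module D.Alg V]

/-- The weight space `V_𝔪 = {v : 𝔪 v = 0}`. -/
def weightSpace (m : MaximalSpectrum R) : AddSubgroup V where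
  carrier := {v | ∀ r ∈ m.asIdeal, D.ofR r • v = 0}
  zero_mem' _ _ := smul_zero _
  add_mem' ha hb r hr := by rw [smul_add, ha r hr, hb r hr, add_zero]
  neg_mem' ha r hr := by rw [smul_neg, ha r hr, neg_zero]

/-- `V` is a weight module: the direct sum of its weight spaces. -/
def IsWeightModule : Prop := DirectSum.IsInternal fun m => D.weightSpace V m

/-- The support of `V`. -/
def support : Set (MaximalSpectrum R) := {m | D.weightSpace V m ≠ ⊥}

variable {D} (ω : D.Orbit)

/-- `F : V × V → R_ω` is an admissible form. -/
structure IsAdmissibleForm (F : V → V → ω.Rω) : Prop where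
  add_left : ∀ v₁ v₂ w, F (v₁ + v₂) w = F v₁ w + F v₂ w
  add_right : ∀ v w₁ w₂, F v (w₁ + w₂) = F v w₁ + F v w₂
  smul_left : ∀ (r : R) v w, F (D.ofR r • v) w = r • F v w
  homogeneous : ∀ (n : ℤ) (a : D.Alg), D.IsHomogeneous n a →
    ∀ v w, F (a • v) w = ((ω.sigma.toEquiv : Equiv.Perm ω.Rω) ^ n) (F v (star a • w))

/-- A weight module `V` with support in `ω` is pseudo-unitarizable if it has a non-degenerate
admissible form. -/
def IsPseudoUnitarizable : Prop :=
  D.IsWeightModule V ∧ D.support V ⊆ ω.carrier ∧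
    ∃ F : V → V → ω.Rω, IsAdmissibleForm V ω F ∧
      ∀ v, v ≠ 0 → ∃ w₁ w₂, F w₁ v ≠ 0 ∧ F v w₂ ≠ 0

/-- The additive group of maps `φ : V → R_ω` which are additive, satisfy `φ(rv) = r* φ(v)`, and
vanish on all but finitely many of the weight spaces `V_𝔪`, `𝔪 ∈ ω`. -/
def finDualSubgroup : AddSubgroup (V →+ ω.Rω) where
  carrier := {φ | (∀ (r : R) (v : V), φ (D.ofR r • v) = star r • φ v) ∧
    {m : ω.carrier | ∃ v ∈ D.weightSpace V m, φ v ≠ 0}.Finite}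
  zero_mem' := by simp
  add_mem' := by
    rintro φ ψ ⟨h1, h2⟩ ⟨h3, h4⟩
    refine ⟨fun r v => by simp [h1, h3], (h2.union h4).subset ?_⟩
    rintro m ⟨v, hv, hne⟩
    by_contra hcon
    simp only [Set.mem_union, Set.mem_ofPred_eq, not_or, not_exists, not_and, not_not] at hcon
    exact hne (by rw [AddMonoidHom.add_apply, hcon.1 v hv, hcon.2 v hv, add_zero])
  neg_mem' := by
    rintro φ ⟨h1, h2⟩
    exact ⟨fun r v => by simp [h1], by simpa using h2⟩

/-- The finitistic dual `V^♯` of `V`. -/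
def FinDual : Type (max u v) := finDualSubgroup V ω

instance : AddCommGroup (FinDual V ω) := inferInstanceAs (AddCommGroup (finDualSubgroup V ω))

/-- The action of an element of `A` on `V`. -/
def act (a : D.Alg) : V →+ V := DistribSMul.toAddMonoidHom V a

variable {V}

theorem X_smul_mem {m : MaximalSpectrum R} {v : V} (hv : v ∈ D.weightSpace V m) :
    D.X • v ∈ D.weightSpace V (D.σMax m) := by
  intro r hr
  have h := D.X_mul_ofR (D.σ.symm r)
  rw [RingEquiv.apply_symm_apply] at h
  rw [← mul_smul, ← h, mul_smul, hv _ hr, smul_zero]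

theorem Y_smul_mem {m : MaximalSpectrum R} {v : V} (hv : v ∈ D.weightSpace V m) :
    D.Y • v ∈ D.weightSpace V (D.σMax.symm m) := by
  intro r hr
  have h := D.Y_mul_ofR (D.σ r)
  rw [RingEquiv.symm_apply_apply] at h
  rw [← mul_smul, ← h, mul_smul, hv _ hr, smul_zero]

namespace FinDual

/-- An element of `V^♯`, as an additive map `V → R_ω`. -/
def toHom {V : Type v} [AddCommGroup V] [Module D.Alg V] {ω : D.Orbit} (φ : FinDual V ω) :
    V →+ ω.Rω := φ.1

variable {ω}

theorem ext {φ ψ : FinDual V ω} (h : ∀ v, φ.toHom v = ψ.toHom v) : φ = ψ :=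
  Subtype.ext (AddMonoidHom.ext h)

theorem map_ofR_smul (φ : FinDual V ω) (r : R) (v : V) :
    φ.toHom (D.ofR r • v) = star r • φ.toHom v := φ.2.1 r v

theorem finite (φ : FinDual V ω) :
    {m : ω.carrier | ∃ v ∈ D.weightSpace V m, φ.toHom v ≠ 0}.Finite := φ.2.2

variable (V ω)

/-- The action of `r ∈ R` on `V^♯`: `(rφ)(v) = r φ(v)`. -/
def actR (r : R) : AddMonoid.End (FinDual V ω) where
  toFun φ := ⟨(DistribSMul.toAddMonoidHom ω.Rω r).comp φ.toHom, by
    constructor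
    · intro s v
      show r • φ.toHom _ = star s • (r • φ.toHom v)
      rw [map_ofR_smul, smul_comm]
    · refine φ.finite.subset ?_
      rintro m ⟨v, hv, hne⟩
      exact ⟨v, hv, fun h => hne (by show r • φ.toHom v = 0; rw [h, smul_zero])⟩⟩
  map_zero' := ext fun _ => smul_zero r
  map_add' _ _ := ext fun _ => smul_add r _ _

/-- The action of `X` on `V^♯`: `(Xφ)(v) = σ(φ(Yv))`. -/
def actX : AddMonoid.End (FinDual V ω) where
  toFun φ := ⟨ω.sigma.toAddMonoidHom.comp (φ.toHom.comp (act V D.Y)), by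
    constructor
    · intro s v
      show ω.sigma (φ.toHom (D.Y • D.ofR s • v)) = star s • ω.sigma (φ.toHom (D.Y • v))
      rw [← mul_smul, D.Y_mul_ofR, mul_smul, map_ofR_smul, ω.sigma_smul, D.σ_star,
        RingEquiv.apply_symm_apply]
    · refine (φ.finite.image ω.next).subset ?_
      rintro m ⟨v, hv, hne⟩
      refine ⟨ω.prev m, ⟨D.Y • v, Y_smul_mem hv, fun h => hne ?_⟩, ω.next_prev m⟩
      show ω.sigma (φ.toHom (D.Y • v)) = 0
      rw [h, map_zero]⟩
  map_zero' := ext fun _ => map_zero ω.sigma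
  map_add' _ _ := ext fun _ => map_add ω.sigma _ _

/-- The action of `Y` on `V^♯`: `(Yφ)(v) = σ⁻¹(φ(Xv))`. -/
def actY : AddMonoid.End (FinDual V ω) where
  toFun φ := ⟨ω.sigma.symm.toAddMonoidHom.comp (φ.toHom.comp (act V D.X)), by
    constructor
    · intro s v
      show ω.sigma.symm (φ.toHom (D.X • D.ofR s • v)) = star s • ω.sigma.symm (φ.toHom (D.X • v))
      rw [← mul_smul, D.X_mul_ofR, mul_smul, map_ofR_smul, ω.sigma_symm_smul, ← D.σ_star,
        RingEquiv.symm_apply_apply]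
    · refine (φ.finite.image ω.prev).subset ?_
      rintro m ⟨v, hv, hne⟩
      refine ⟨ω.next m, ⟨D.X • v, X_smul_mem hv, fun h => hne ?_⟩, ω.prev_next m⟩
      show ω.sigma.symm (φ.toHom (D.X • v)) = 0
      rw [h, map_zero]⟩
  map_zero' := ext fun _ => map_zero ω.sigma.symm
  map_add' _ _ := ext fun _ => map_add ω.sigma.symm _ _

/-- The action of `R` on `V^♯` as a ring homomorphism. -/
def actRHom : R →+* AddMonoid.End (FinDual V ω) where
  toFun := actR V ω
  map_one' := by ext φ; exact ext fun _ => one_smul R _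
  map_mul' r s := by ext φ; exact ext fun _ => mul_smul r s _
  map_zero' := by ext φ; exact ext fun _ => zero_smul R _
  map_add' r s := by ext φ; exact ext fun _ => add_smul r s _

/-- The action of `A` on `V^♯`. -/
def actHom : D.Alg →+* AddMonoid.End (FinDual V ω) :=
  D.lift (actRHom V ω) (actX V ω) (actY V ω)
    (by
      ext φ
      refine ext fun v => ?_
      show ω.sigma.symm (ω.sigma (φ.toHom (D.Y • D.X • v))) = D.t • φ.toHom v
      rw [AddEquiv.symm_apply_apply, ← mul_smul, D.Y_mul_X, map_ofR_smul, D.t_star])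
    (by
      ext φ
      refine ext fun v => ?_
      show ω.sigma (ω.sigma.symm (φ.toHom (D.X • D.Y • v))) = D.σ D.t • φ.toHom v
      rw [AddEquiv.apply_symm_apply, ← mul_smul, D.X_mul_Y, map_ofR_smul, ← D.σ_star, D.t_star])
    (by
      intro r
      ext φ
      exact ext fun v => ω.sigma_smul r _)
    (by
      intro r
      ext φ
      exact ext fun v => ω.sigma_symm_smul r _)

end FinDual

/-- The `A`-module structure on `V^♯` determined by `(rφ)(v) = r φ(v)`, `(Xφ)(v) = σ(φ(Yv))` and
`(Yφ)(v) = σ⁻¹(φ(Xv))`. -/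
instance : Module D.Alg (FinDual V ω) := Module.compHom _ (FinDual.actHom V ω)

theorem FinDual.ofR_smul_apply (r : R) (φ : FinDual V ω) (v : V) :
    (D.ofR r • φ).toHom v = r • φ.toHom v := by
  show ((FinDual.actHom V ω (D.ofR r)) φ).toHom v = _
  rw [FinDual.actHom, lift_ofR]
  rfl

theorem FinDual.X_smul_apply (φ : FinDual V ω) (v : V) :
    (D.X • φ).toHom v = ω.sigma (φ.toHom (D.Y • v)) := by
  show ((FinDual.actHom V ω D.X) φ).toHom v = _
  rw [FinDual.actHom, lift_X]
  rfl

theorem FinDual.Y_smul_apply (φ : FinDual V ω) (v : V) :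
    (D.Y • φ).toHom v = ω.sigma.symm (φ.toHom (D.X • v)) := by
  show ((FinDual.actHom V ω D.Y) φ).toHom v = _
  rw [FinDual.actHom, lift_Y]
  rfl

end modules

/-! ### The labelling of a finite orbit by its breaks -/

namespace Orbit

/-- The index `j(𝔪) ∈ ℤ_m`, where `m` is the number of breaks of the finite orbit `ω` and `m₀ ∈ ω`
is the chosen break with label `0`: if `𝔪 = σᵃ(m₀)` with `a ≥ 0` least possible, then `j(𝔪)` is the
number of breaks among `m₀, σ(m₀), …, σᵃ⁻¹(m₀)`. So if the breaks are labelled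
`m₀ = 𝔪_0, 𝔪_1, …, 𝔪_{m-1}` in the cyclic order in which `σ` meets them, then `j(𝔪) = i` for the
elements `𝔪` which occur after `𝔪_{i-1}`, up to and including `𝔪_i`. -/
def jIndex (ω : D.Orbit) (m₀ m : MaximalSpectrum R) : ZMod ω.breaks.ncard :=
  (Nat.count (fun i => (D.σMax ^ i) m₀ ∈ ω.breaks) (sInf {a : ℕ | (D.σMax ^ a) m₀ = m}) : ℕ)

theorem jIndex_self (ω : D.Orbit) (m₀ : MaximalSpectrum R) : ω.jIndex m₀ m₀ = 0 := by
  have h : sInf {a : ℕ | (D.σMax ^ a) m₀ = m₀} = 0 := Nat.sInf_eq_zero.2 (Or.inl rfl)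
  rw [jIndex, h, Nat.count_zero, Nat.cast_zero]

theorem pow_mem (ω : D.Orbit) {m₀ : MaximalSpectrum R} (hm₀ : m₀ ∈ ω.carrier) (a : ℕ) :
    (D.σMax ^ a) m₀ ∈ ω.carrier := by
  induction a with
  | zero => exact hm₀
  | succ a ih =>
    rw [pow_succ', Equiv.Perm.mul_apply]
    exact ω.σMax_mem ih

theorem mem_periodicPts (ω : D.Orbit) (hfin : ω.carrier.Finite) {m₀ : MaximalSpectrum R}
    (hm₀ : m₀ ∈ ω.carrier) : m₀ ∈ Function.periodicPts D.σMax := by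
  have hmaps : Set.MapsTo (fun a : ℕ => (D.σMax ^ a) m₀) Set.univ ω.carrier :=
    fun a _ => ω.pow_mem hm₀ a
  obtain ⟨a, -, b, -, hab, h⟩ :=
    Set.infinite_univ.exists_ne_map_eq_of_mapsTo hmaps hfin
  have key : ∀ a b : ℕ, a < b → (D.σMax ^ a) m₀ = (D.σMax ^ b) m₀ →
      m₀ ∈ Function.periodicPts D.σMax := by
    intro a b hlt h
    refine ⟨b - a, Nat.sub_pos_of_lt hlt, ?_⟩
    rw [Function.IsPeriodicPt, Function.IsFixedPt, ← Equiv.Perm.coe_pow]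
    apply (D.σMax ^ a).injective
    rw [← Equiv.Perm.mul_apply, ← pow_add, Nat.add_sub_cancel' hlt.le, h]
  rcases lt_or_gt_of_ne hab with hlt | hlt
  · exact key a b hlt h
  · exact key b a hlt h.symm

theorem exists_pow_eq (ω : D.Orbit) (hfin : ω.carrier.Finite) {m₀ m : MaximalSpectrum R}
    (hm₀ : m₀ ∈ ω.carrier) (hm : m ∈ ω.carrier) :
    ∃ a < Function.minimalPeriod D.σMax m₀, (D.σMax ^ a) m₀ = m := by
  have hpos := Function.minimalPeriod_pos_of_mem_periodicPts (ω.mem_periodicPts hfin hm₀)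
  obtain ⟨m₁, h₁⟩ := ω.isOrbit
  obtain ⟨n₀, h₀⟩ := (h₁ m₀).1 hm₀
  obtain ⟨n, hn⟩ := (h₁ m).1 hm
  have h : (D.σMax ^ (n - n₀)) m₀ = m := by
    rw [← h₀, ← Equiv.Perm.mul_apply, ← zpow_add, sub_add_cancel, hn]
  set p := Function.minimalPeriod D.σMax m₀ with hp
  have hfix : (D.σMax ^ p) m₀ = m₀ := by
    rw [Equiv.Perm.coe_pow]
    exact Function.isPeriodicPt_minimalPeriod D.σMax m₀
  have hp0 : (p : ℤ) ≠ 0 := by exact_mod_cast hpos.ne'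
  refine ⟨((n - n₀) % p).toNat, ?_, ?_⟩
  · have := Int.emod_lt_of_pos (n - n₀) (by exact_mod_cast hpos : (0 : ℤ) < p)
    have := Int.emod_nonneg (n - n₀) hp0
    omega
  · rw [← zpow_natCast, Int.toNat_of_nonneg (Int.emod_nonneg _ hp0), ← h]
    conv_rhs => rw [← Int.emod_add_mul_ediv (n - n₀) p, zpow_add, Equiv.Perm.mul_apply, zpow_mul]
    congr 1
    have hfix' : Function.IsFixedPt (D.σMax ^ (p : ℤ)) m₀ := by
      rw [zpow_natCast]
      exact hfix
    exact (hfix'.perm_zpow _).symm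

theorem count_period (ω : D.Orbit) (hfin : ω.carrier.Finite) {m₀ : MaximalSpectrum R}
    (hm₀ : m₀ ∈ ω.carrier) :
    Nat.count (fun i => (D.σMax ^ i) m₀ ∈ ω.breaks) (Function.minimalPeriod D.σMax m₀) =
      ω.breaks.ncard := by
  rw [Nat.count_eq_card_filter_range, ← Set.ncard_coe_finset]
  apply Set.ncard_congr (fun a _ => (D.σMax ^ a) m₀)
  · intro a ha
    exact (Finset.mem_filter.1 (Finset.mem_coe.1 ha)).2
  · intro a b ha hb h
    have ha' := Finset.mem_range.1 (Finset.mem_filter.1 (Finset.mem_coe.1 ha)).1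
    have hb' := Finset.mem_range.1 (Finset.mem_filter.1 (Finset.mem_coe.1 hb)).1
    simp only [Equiv.Perm.coe_pow] at h
    exact (Function.iterate_eq_iterate_iff_of_lt_minimalPeriod ha' hb').1 h
  · intro m hm
    obtain ⟨a, ha, rfl⟩ := ω.exists_pow_eq hfin hm₀ hm.1
    exact ⟨a, Finset.mem_coe.2 (Finset.mem_filter.2 ⟨Finset.mem_range.2 ha, hm⟩), rfl⟩

/-- The count of breaks computes `j` for every way to reach a member of the orbit from `m₀`. -/
theorem jIndex_pow (ω : D.Orbit) (hfin : ω.carrier.Finite) {m₀ : MaximalSpectrum R}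
    (hm₀ : m₀ ∈ ω.carrier) (a : ℕ) :
    ω.jIndex m₀ ((D.σMax ^ a) m₀) =
      (Nat.count (fun i => (D.σMax ^ i) m₀ ∈ ω.breaks) a : ℕ) := by
  have hpos := Function.minimalPeriod_pos_of_mem_periodicPts (ω.mem_periodicPts hfin hm₀)
  induction a using Nat.strong_induction_on with
  | _ a ih =>
    by_cases hlt : a < Function.minimalPeriod D.σMax m₀
    · have h : sInf {b : ℕ | (D.σMax ^ b) m₀ = (D.σMax ^ a) m₀} = a := by
        have hne : {b : ℕ | (D.σMax ^ b) m₀ = (D.σMax ^ a) m₀}.Nonempty := ⟨a, rfl⟩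
        have h1 := Nat.sInf_mem hne
        have h2 : sInf {b : ℕ | (D.σMax ^ b) m₀ = (D.σMax ^ a) m₀} ≤ a := Nat.sInf_le rfl
        change (D.σMax ^ _) m₀ = (D.σMax ^ a) m₀ at h1
        simp only [Equiv.Perm.coe_pow] at h1 h2 ⊢
        exact (Function.iterate_eq_iterate_iff_of_lt_minimalPeriod (h2.trans_lt hlt) hlt).1 h1
      rw [jIndex, h]
    · obtain ⟨b, rfl⟩ := Nat.exists_eq_add_of_le (not_lt.1 hlt)
      have hfix : ∀ k, (D.σMax ^ (Function.minimalPeriod D.σMax m₀ + k)) m₀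
          = (D.σMax ^ k) m₀ := by
        intro k
        rw [add_comm, pow_add, Equiv.Perm.mul_apply]
        congr 1
        rw [Equiv.Perm.coe_pow]
        exact Function.isPeriodicPt_minimalPeriod D.σMax m₀
      rw [hfix, ih b (by omega), Nat.count_add, ω.count_period hfin hm₀, Nat.cast_add,
        ZMod.natCast_self, zero_add]
      simp only [hfix]

theorem jIndex_next (ω : D.Orbit) (hfin : ω.carrier.Finite) {m₀ : MaximalSpectrum R}
    (hm₀ : m₀ ∈ ω.carrier) (m : ω.carrier) :
    ω.jIndex m₀ (ω.next m) =
      ω.jIndex m₀ m + if D.t ∈ (m : MaximalSpectrum R).asIdeal then 1 else 0 := by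
  obtain ⟨m, hm⟩ := m
  obtain ⟨a, -, rfl⟩ := ω.exists_pow_eq hfin hm₀ hm
  have h : ((ω.next ⟨(D.σMax ^ a) m₀, hm⟩ : ω.carrier) : MaximalSpectrum R)
      = (D.σMax ^ (a + 1)) m₀ := by
    rw [pow_succ', Equiv.Perm.mul_apply]
    rfl
  have hb : (D.σMax ^ a) m₀ ∈ ω.breaks ↔ D.t ∈ ((D.σMax ^ a) m₀).asIdeal :=
    ⟨fun h => h.2, fun h => ⟨hm, h⟩⟩
  rw [h, ω.jIndex_pow hfin hm₀, ω.jIndex_pow hfin hm₀, Nat.count_succ]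
  simp only [hb]
  split_ifs <;> simp

theorem jIndex_next_of_mem (ω : D.Orbit) (hfin : ω.carrier.Finite) {m₀ : MaximalSpectrum R}
    (hm₀ : m₀ ∈ ω.carrier) {m : ω.carrier} (h : D.t ∈ (m : MaximalSpectrum R).asIdeal) :
    ω.jIndex m₀ (ω.next m) = ω.jIndex m₀ m + 1 := by
  rw [ω.jIndex_next hfin hm₀, if_pos h]

theorem jIndex_next_of_notMem (ω : D.Orbit) (hfin : ω.carrier.Finite) {m₀ : MaximalSpectrum R}
    (hm₀ : m₀ ∈ ω.carrier) {m : ω.carrier} (h : D.t ∉ (m : MaximalSpectrum R).asIdeal) :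
    ω.jIndex m₀ (ω.next m) = ω.jIndex m₀ m := by
  rw [ω.jIndex_next hfin hm₀, if_neg h, add_zero]

end Orbit

/-! ### The modules of the first kind -/

/-- The two letters `x` and `y`. -/
inductive Letter
  | x : Letter
  | y : Letter

/-- The exchange of the two letters. -/
def Letter.swap : Letter → Letter
  | .x => .y
  | .y => .x

/-- The elements of the free monoid on `x, y`. The letter `z_{k+1}` of `w = z₁z₂⋯zₙ` is `w[k]?`. -/
abbrev Word := List Letter

/-- The word `w^♯` obtained from `w` by exchanging `x` and `y`. -/
def Word.sharp (w : Word) : Word := w.map Letter.swap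

/-- The pairs `[𝔪, e_k]`, with `𝔪 ∈ ω`, `0 ≤ k ≤ n` and `j + k = j(𝔪)` in `ℤ_m`, where `n` is the
length of `w`. -/
abbrev FirstKindIndex (ω : D.Orbit) (m₀ : MaximalSpectrum R) (j : ZMod ω.breaks.ncard)
    (w : Word) : Type u :=
  {b : ω.carrier × Fin (w.length + 1) // j + ((b.2 : ℕ) : ZMod ω.breaks.ncard) = ω.jIndex m₀ b.1}

/-- If `𝔪` is not a break then `[σ(𝔪), e_k]` is a pair whenever `[𝔪, e_k]` is. -/
def FirstKindIndex.next {ω : D.Orbit} (hfin : ω.carrier.Finite) {m₀ : MaximalSpectrum R}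
    (hm₀ : m₀ ∈ ω.breaks) {j : ZMod ω.breaks.ncard} {w : Word} (b : FirstKindIndex ω m₀ j w)
    (h : D.t ∉ (b.1.1 : MaximalSpectrum R).asIdeal) : FirstKindIndex ω m₀ j w :=
  ⟨(ω.next b.1.1, b.1.2), by
    rw [ω.jIndex_next_of_notMem hfin hm₀.1 h]
    exact b.2⟩

/-- If `𝔪` is a break and `k < n` then `[σ(𝔪), e_{k+1}]` is a pair whenever `[𝔪, e_k]` is. -/
def FirstKindIndex.nextSucc {ω : D.Orbit} (hfin : ω.carrier.Finite) {m₀ : MaximalSpectrum R}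
    (hm₀ : m₀ ∈ ω.breaks) {j : ZMod ω.breaks.ncard} {w : Word} (b : FirstKindIndex ω m₀ j w)
    (h : D.t ∈ (b.1.1 : MaximalSpectrum R).asIdeal) (hk : (b.1.2 : ℕ) < w.length) :
    FirstKindIndex ω m₀ j w :=
  ⟨(ω.next b.1.1, ⟨b.1.2 + 1, Nat.succ_lt_succ hk⟩), by
    rw [ω.jIndex_next_of_mem hfin hm₀.1 h, ← b.2, Nat.cast_add, Nat.cast_one, add_assoc]⟩

/-- If `σ⁻¹(𝔪)` is not a break then `[σ⁻¹(𝔪), e_k]` is a pair whenever `[𝔪, e_k]` is. -/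
def FirstKindIndex.prev {ω : D.Orbit} (hfin : ω.carrier.Finite) {m₀ : MaximalSpectrum R}
    (hm₀ : m₀ ∈ ω.breaks) {j : ZMod ω.breaks.ncard} {w : Word} (b : FirstKindIndex ω m₀ j w)
    (h : D.t ∉ (ω.prev b.1.1 : MaximalSpectrum R).asIdeal) : FirstKindIndex ω m₀ j w :=
  ⟨(ω.prev b.1.1, b.1.2), by
    rw [← ω.jIndex_next_of_notMem hfin hm₀.1 h, ω.next_prev]
    exact b.2⟩

/-- If `σ⁻¹(𝔪)` is a break and `k ≥ 1` then `[σ⁻¹(𝔪), e_{k-1}]` is a pair whenever `[𝔪, e_k]`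
is. -/
def FirstKindIndex.prevPred {ω : D.Orbit} (hfin : ω.carrier.Finite) {m₀ : MaximalSpectrum R}
    (hm₀ : m₀ ∈ ω.breaks) {j : ZMod ω.breaks.ncard} {w : Word} (b : FirstKindIndex ω m₀ j w)
    (h : D.t ∈ (ω.prev b.1.1 : MaximalSpectrum R).asIdeal) (hk : 1 ≤ (b.1.2 : ℕ)) :
    FirstKindIndex ω m₀ j w :=
  ⟨(ω.prev b.1.1, ⟨b.1.2 - 1, (Nat.sub_le _ _).trans_lt b.1.2.2⟩), by
    have h1 := ω.jIndex_next_of_mem hfin hm₀.1 h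
    rw [ω.next_prev, ← b.2] at h1
    have h2 : ((b.1.2 : ℕ) : ZMod ω.breaks.ncard) = (((b.1.2 : ℕ) - 1 : ℕ) : ZMod _) + 1 := by
      have h3 := congrArg (Nat.cast : ℕ → ZMod ω.breaks.ncard) (Nat.sub_add_cancel hk)
      rw [Nat.cast_add, Nat.cast_one] at h3
      exact h3.symm
    rw [h2, ← add_assoc] at h1
    exact add_right_cancel h1⟩

/-- The module `V(ω, j, w)`, for a finite orbit `ω` with a chosen break `m₀`: as an `R`-module it
is the direct sum of the spaces `R/𝔪` over the pairs `[𝔪, e_k]`. -/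
@[nolint unusedArguments]
def FirstKind (ω : D.Orbit) (_hfin : ω.carrier.Finite) (m₀ : MaximalSpectrum R)
    (_hm₀ : m₀ ∈ ω.breaks) (j : ZMod ω.breaks.ncard) (w : Word) : Type u :=
  ⨁ b : FirstKindIndex ω m₀ j w, R ⧸ (b.1.1 : MaximalSpectrum R).asIdeal

namespace FirstKind

variable (ω : D.Orbit) (hfin : ω.carrier.Finite) (m₀ : MaximalSpectrum R)
  (hm₀ : m₀ ∈ ω.breaks) (j : ZMod ω.breaks.ncard) (w : Word)

instance : AddCommGroup (FirstKind ω hfin m₀ hm₀ j w) :=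
  inferInstanceAs (AddCommGroup
    (⨁ b : FirstKindIndex ω m₀ j w, R ⧸ (b.1.1 : MaximalSpectrum R).asIdeal))

instance : Module R (FirstKind ω hfin m₀ hm₀ j w) :=
  inferInstanceAs (Module R
    (⨁ b : FirstKindIndex ω m₀ j w, R ⧸ (b.1.1 : MaximalSpectrum R).asIdeal))

variable {ω m₀ j w}

/-- The map `λ ↦ λ [𝔪, e_k]` from `R/𝔪` to `V(ω, j, w)`. -/
def basis (b : FirstKindIndex ω m₀ j w) :
    R ⧸ (b.1.1 : MaximalSpectrum R).asIdeal →+ FirstKind ω hfin m₀ hm₀ j w :=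
  DirectSum.of (fun b : FirstKindIndex ω m₀ j w => R ⧸ (b.1.1 : MaximalSpectrum R).asIdeal) b

theorem basis_congr {b b' : FirstKindIndex ω m₀ j w} (h : b = b') (r : R) :
    basis hfin hm₀ b (Ideal.Quotient.mk _ r) = basis hfin hm₀ b' (Ideal.Quotient.mk _ r) := by
  subst h
  rfl

theorem smul_basis (b : FirstKindIndex ω m₀ j w) (r s : R) :
    r • basis hfin hm₀ b (Ideal.Quotient.mk _ s) =
      basis hfin hm₀ b (Ideal.Quotient.mk _ (r * s)) := by
  show r • (DirectSum.of
    (fun b : FirstKindIndex ω m₀ j w => R ⧸ (b.1.1 : MaximalSpectrum R).asIdeal) b _) =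
    DirectSum.of
      (fun b : FirstKindIndex ω m₀ j w => R ⧸ (b.1.1 : MaximalSpectrum R).asIdeal) b _
  rw [← DirectSum.lof_eq_of R, ← map_smul, ← DirectSum.lof_eq_of R]
  rfl

theorem hom_ext {M : Type*} [AddMonoid M] {f g : FirstKind ω hfin m₀ hm₀ j w →+ M}
    (h : ∀ (b : FirstKindIndex ω m₀ j w) (r : R), f (basis hfin hm₀ b (Ideal.Quotient.mk _ r)) =
      g (basis hfin hm₀ b (Ideal.Quotient.mk _ r))) : f = g := by
  apply DirectSum.addHom_ext
  intro b x
  obtain ⟨r, rfl⟩ := Ideal.Quotient.mk_surjective x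
  exact h b r

/-- The action of `X` on the multiples of `[𝔪, e_k]`:
`X λ[𝔪, e_k] = σ(t_𝔪 λ) [σ(𝔪), e_k]` if `𝔪` is not a break,
`X λ[𝔪, e_k] = σ(λ) [σ(𝔪), e_{k+1}]` if `𝔪` is a break and `z_{k+1} = x`,
and `0` otherwise. -/
def XBasis (b : FirstKindIndex ω m₀ j w) :
    R ⧸ (b.1.1 : MaximalSpectrum R).asIdeal →+ FirstKind ω hfin m₀ hm₀ j w :=
  if h : D.t ∉ (b.1.1 : MaximalSpectrum R).asIdeal then
    (basis hfin hm₀ (b.next hfin hm₀ h)).comp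
      ((D.quotσ _).toAddMonoidHom.comp (AddMonoidHom.mulLeft (Ideal.Quotient.mk _ D.t)))
  else if hz : w[(b.1.2 : ℕ)]? = some Letter.x then
    (basis hfin hm₀ (b.nextSucc hfin hm₀ (not_not.1 h)
      (List.getElem?_eq_some_iff.1 hz).1)).comp (D.quotσ _).toAddMonoidHom
  else 0

/-- The action of `Y` on the multiples of `[𝔪, e_k]`:
`Y λ[𝔪, e_k] = σ⁻¹(λ) [σ⁻¹(𝔪), e_k]` if `σ⁻¹(𝔪)` is not a break,
`Y λ[𝔪, e_k] = σ⁻¹(λ) [σ⁻¹(𝔪), e_{k-1}]` if `σ⁻¹(𝔪)` is a break, `k ≥ 1` and `z_k = y`,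
and `0` otherwise. -/
def YBasis (b : FirstKindIndex ω m₀ j w) :
    R ⧸ (b.1.1 : MaximalSpectrum R).asIdeal →+ FirstKind ω hfin m₀ hm₀ j w :=
  if h : D.t ∉ (ω.prev b.1.1 : MaximalSpectrum R).asIdeal then
    (basis hfin hm₀ (b.prev hfin hm₀ h)).comp (D.quotσInv _).toAddMonoidHom
  else if hz : 1 ≤ (b.1.2 : ℕ) ∧ w[(b.1.2 : ℕ) - 1]? = some Letter.y then
    (basis hfin hm₀ (b.prevPred hfin hm₀ (not_not.1 h) hz.1)).comp (D.quotσInv _).toAddMonoidHom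
  else 0

variable (ω m₀ j w)

/-- The action of `X` on `V(ω, j, w)`. -/
def actX : AddMonoid.End (FirstKind ω hfin m₀ hm₀ j w) :=
  DirectSum.toAddMonoid (XBasis hfin hm₀)

/-- The action of `Y` on `V(ω, j, w)`. -/
def actY : AddMonoid.End (FirstKind ω hfin m₀ hm₀ j w) :=
  DirectSum.toAddMonoid (YBasis hfin hm₀)

variable {ω m₀ j w}

theorem actX_basis_of_notMem (b : FirstKindIndex ω m₀ j w)
    (h : D.t ∉ (b.1.1 : MaximalSpectrum R).asIdeal) (r : R) :
    actX ω hfin m₀ hm₀ j w (basis hfin hm₀ b (Ideal.Quotient.mk _ r)) =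
      basis hfin hm₀ (b.next hfin hm₀ h) (Ideal.Quotient.mk _ (D.σ (D.t * r))) := by
  refine (DirectSum.toAddMonoid_of _ _ _).trans ?_
  rw [XBasis, dif_pos h]
  rfl

theorem actX_basis_of_mem (b : FirstKindIndex ω m₀ j w)
    (h : D.t ∈ (b.1.1 : MaximalSpectrum R).asIdeal) (hz : w[(b.1.2 : ℕ)]? = some Letter.x)
    (r : R) :
    actX ω hfin m₀ hm₀ j w (basis hfin hm₀ b (Ideal.Quotient.mk _ r)) =
      basis hfin hm₀ (b.nextSucc hfin hm₀ h (List.getElem?_eq_some_iff.1 hz).1)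
        (Ideal.Quotient.mk _ (D.σ r)) := by
  refine (DirectSum.toAddMonoid_of _ _ _).trans ?_
  rw [XBasis, dif_neg (not_not.2 h), dif_pos hz]
  rfl

theorem actX_basis_eq_zero (b : FirstKindIndex ω m₀ j w)
    (h : D.t ∈ (b.1.1 : MaximalSpectrum R).asIdeal) (hz : w[(b.1.2 : ℕ)]? ≠ some Letter.x)
    (r : R) :
    actX ω hfin m₀ hm₀ j w (basis hfin hm₀ b (Ideal.Quotient.mk _ r)) = 0 := by
  refine (DirectSum.toAddMonoid_of _ _ _).trans ?_
  rw [XBasis, dif_neg (not_not.2 h), dif_neg hz]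
  rfl

theorem actY_basis_of_notMem (b : FirstKindIndex ω m₀ j w)
    (h : D.t ∉ (ω.prev b.1.1 : MaximalSpectrum R).asIdeal) (r : R) :
    actY ω hfin m₀ hm₀ j w (basis hfin hm₀ b (Ideal.Quotient.mk _ r)) =
      basis hfin hm₀ (b.prev hfin hm₀ h) (Ideal.Quotient.mk _ (D.σ.symm r)) := by
  refine (DirectSum.toAddMonoid_of _ _ _).trans ?_
  rw [YBasis, dif_pos h]
  rfl

theorem actY_basis_of_mem (b : FirstKindIndex ω m₀ j w)
    (h : D.t ∈ (ω.prev b.1.1 : MaximalSpectrum R).asIdeal)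
    (hz : 1 ≤ (b.1.2 : ℕ) ∧ w[(b.1.2 : ℕ) - 1]? = some Letter.y) (r : R) :
    actY ω hfin m₀ hm₀ j w (basis hfin hm₀ b (Ideal.Quotient.mk _ r)) =
      basis hfin hm₀ (b.prevPred hfin hm₀ h hz.1) (Ideal.Quotient.mk _ (D.σ.symm r)) := by
  refine (DirectSum.toAddMonoid_of _ _ _).trans ?_
  rw [YBasis, dif_neg (not_not.2 h), dif_pos hz]
  rfl

theorem actY_basis_eq_zero (b : FirstKindIndex ω m₀ j w)
    (h : D.t ∈ (ω.prev b.1.1 : MaximalSpectrum R).asIdeal)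
    (hz : ¬ (1 ≤ (b.1.2 : ℕ) ∧ w[(b.1.2 : ℕ) - 1]? = some Letter.y)) (r : R) :
    actY ω hfin m₀ hm₀ j w (basis hfin hm₀ b (Ideal.Quotient.mk _ r)) = 0 := by
  refine (DirectSum.toAddMonoid_of _ _ _).trans ?_
  rw [YBasis, dif_neg (not_not.2 h), dif_neg hz]
  rfl

theorem basis_eq_zero (b : FirstKindIndex ω m₀ j w) {r : R}
    (h : r ∈ (b.1.1 : MaximalSpectrum R).asIdeal) :
    basis hfin hm₀ b (Ideal.Quotient.mk _ r) = 0 := by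
  rw [Ideal.Quotient.eq_zero_iff_mem.2 h, map_zero]

variable (ω m₀ j w)

theorem actY_actX (v : FirstKind ω hfin m₀ hm₀ j w) :
    actY ω hfin m₀ hm₀ j w (actX ω hfin m₀ hm₀ j w v) = D.t • v := by
  have key : (actY ω hfin m₀ hm₀ j w).comp (actX ω hfin m₀ hm₀ j w) =
      DistribSMul.toAddMonoidHom (FirstKind ω hfin m₀ hm₀ j w) D.t := by
    apply hom_ext
    intro b r
    show actY ω hfin m₀ hm₀ j w (actX ω hfin m₀ hm₀ j w _) = D.t • _
    rw [smul_basis]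
    by_cases h : D.t ∈ (b.1.1 : MaximalSpectrum R).asIdeal
    · rw [basis_eq_zero _ _ _ (Ideal.mul_mem_right _ _ h)]
      by_cases hz : w[(b.1.2 : ℕ)]? = some Letter.x
      · rw [actX_basis_of_mem _ _ b h hz, actY_basis_eq_zero]
        · show D.t ∈ (ω.prev (ω.next b.1.1) : MaximalSpectrum R).asIdeal
          rwa [ω.prev_next]
        · rintro ⟨-, h2⟩
          change w[(b.1.2 : ℕ) + 1 - 1]? = _ at h2
          rw [Nat.add_sub_cancel, hz] at h2
          cases h2
      · rw [actX_basis_eq_zero _ _ b h hz, map_zero]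
    · have h' : D.t ∉ (ω.prev (b.next hfin hm₀ h).1.1 : MaximalSpectrum R).asIdeal := by
        show D.t ∉ (ω.prev (ω.next b.1.1) : MaximalSpectrum R).asIdeal
        rwa [ω.prev_next]
      rw [actX_basis_of_notMem _ _ b h, actY_basis_of_notMem _ _ _ h',
        RingEquiv.symm_apply_apply]
      have hb : (b.next hfin hm₀ h).prev hfin hm₀ h' = b :=
        Subtype.ext (Prod.ext (ω.prev_next b.1.1) rfl)
      exact basis_congr hfin hm₀ hb _
  exact DFunLike.congr_fun key v

theorem actX_actY (v : FirstKind ω hfin m₀ hm₀ j w) :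
    actX ω hfin m₀ hm₀ j w (actY ω hfin m₀ hm₀ j w v) = D.σ D.t • v := by
  have key : (actX ω hfin m₀ hm₀ j w).comp (actY ω hfin m₀ hm₀ j w) =
      DistribSMul.toAddMonoidHom (FirstKind ω hfin m₀ hm₀ j w) (D.σ D.t) := by
    apply hom_ext
    intro b r
    show actX ω hfin m₀ hm₀ j w (actY ω hfin m₀ hm₀ j w _) = D.σ D.t • _
    rw [smul_basis]
    by_cases h : D.t ∈ (ω.prev b.1.1 : MaximalSpectrum R).asIdeal
    · have h' : D.σ D.t ∈ (b.1.1 : MaximalSpectrum R).asIdeal := h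
      rw [basis_eq_zero _ _ _ (Ideal.mul_mem_right _ _ h')]
      by_cases hz : 1 ≤ (b.1.2 : ℕ) ∧ w[(b.1.2 : ℕ) - 1]? = some Letter.y
      · rw [actY_basis_of_mem _ _ b h hz, actX_basis_eq_zero _ _ _ h]
        intro h2
        change w[(b.1.2 : ℕ) - 1]? = _ at h2
        rw [hz.2] at h2
        cases h2
      · rw [actY_basis_eq_zero _ _ b h hz, map_zero]
    · rw [actY_basis_of_notMem _ _ b h, actX_basis_of_notMem _ _ _ h, map_mul,
        RingEquiv.apply_symm_apply]
      have hb : (b.prev hfin hm₀ h).next hfin hm₀ h = b :=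
        Subtype.ext (Prod.ext (ω.next_prev b.1.1) rfl)
      exact basis_congr hfin hm₀ hb _
  exact DFunLike.congr_fun key v

theorem actX_smul (r : R) (v : FirstKind ω hfin m₀ hm₀ j w) :
    actX ω hfin m₀ hm₀ j w (r • v) = D.σ r • actX ω hfin m₀ hm₀ j w v := by
  have key : (actX ω hfin m₀ hm₀ j w).comp
        (DistribSMul.toAddMonoidHom (FirstKind ω hfin m₀ hm₀ j w) r) =
      (DistribSMul.toAddMonoidHom (FirstKind ω hfin m₀ hm₀ j w) (D.σ r)).comp
        (actX ω hfin m₀ hm₀ j w) := by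
    apply hom_ext
    intro b s
    show actX ω hfin m₀ hm₀ j w (r • basis hfin hm₀ b (Ideal.Quotient.mk _ s)) =
      D.σ r • actX ω hfin m₀ hm₀ j w (basis hfin hm₀ b (Ideal.Quotient.mk _ s))
    rw [smul_basis]
    by_cases h : D.t ∈ (b.1.1 : MaximalSpectrum R).asIdeal
    · by_cases hz : w[(b.1.2 : ℕ)]? = some Letter.x
      · rw [actX_basis_of_mem _ _ b h hz, actX_basis_of_mem _ _ b h hz, smul_basis, map_mul]
      · rw [actX_basis_eq_zero _ _ b h hz, actX_basis_eq_zero _ _ b h hz, smul_zero]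
    · rw [actX_basis_of_notMem _ _ b h, actX_basis_of_notMem _ _ b h, smul_basis, ← map_mul,
        mul_left_comm]
  exact DFunLike.congr_fun key v

theorem actY_smul (r : R) (v : FirstKind ω hfin m₀ hm₀ j w) :
    actY ω hfin m₀ hm₀ j w (r • v) = D.σ.symm r • actY ω hfin m₀ hm₀ j w v := by
  have key : (actY ω hfin m₀ hm₀ j w).comp
        (DistribSMul.toAddMonoidHom (FirstKind ω hfin m₀ hm₀ j w) r) =
      (DistribSMul.toAddMonoidHom (FirstKind ω hfin m₀ hm₀ j w) (D.σ.symm r)).comp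
        (actY ω hfin m₀ hm₀ j w) := by
    apply hom_ext
    intro b s
    show actY ω hfin m₀ hm₀ j w (r • basis hfin hm₀ b (Ideal.Quotient.mk _ s)) =
      D.σ.symm r • actY ω hfin m₀ hm₀ j w (basis hfin hm₀ b (Ideal.Quotient.mk _ s))
    rw [smul_basis]
    by_cases h : D.t ∈ (ω.prev b.1.1 : MaximalSpectrum R).asIdeal
    · by_cases hz : 1 ≤ (b.1.2 : ℕ) ∧ w[(b.1.2 : ℕ) - 1]? = some Letter.y
      · rw [actY_basis_of_mem _ _ b h hz, actY_basis_of_mem _ _ b h hz, smul_basis, map_mul]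
      · rw [actY_basis_eq_zero _ _ b h hz, actY_basis_eq_zero _ _ b h hz, smul_zero]
    · rw [actY_basis_of_notMem _ _ b h, actY_basis_of_notMem _ _ b h, smul_basis, map_mul]
  exact DFunLike.congr_fun key v

/-- The action of `A` on `V(ω, j, w)`. -/
def actHom : D.Alg →+* AddMonoid.End (FirstKind ω hfin m₀ hm₀ j w) :=
  D.lift (Module.toAddMonoidEnd R (FirstKind ω hfin m₀ hm₀ j w))
    (actX ω hfin m₀ hm₀ j w) (actY ω hfin m₀ hm₀ j w)
    (DFunLike.ext _ _ fun v => actY_actX ω hfin m₀ hm₀ j w v)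
    (DFunLike.ext _ _ fun v => actX_actY ω hfin m₀ hm₀ j w v)
    (fun r => DFunLike.ext _ _ fun v => actX_smul ω hfin m₀ hm₀ j w r v)
    (fun r => DFunLike.ext _ _ fun v => actY_smul ω hfin m₀ hm₀ j w r v)

/-- The `A`-module structure on `V(ω, j, w)`. -/
instance : Module D.Alg (FirstKind ω hfin m₀ hm₀ j w) :=
  Module.compHom _ (actHom ω hfin m₀ hm₀ j w)

variable {ω m₀ j w}

theorem ofR_smul (r : R) (v : FirstKind ω hfin m₀ hm₀ j w) : D.ofR r • v = r • v := by
  show actHom ω hfin m₀ hm₀ j w (D.ofR r) v = _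
  rw [actHom, lift_ofR]
  rfl

theorem X_smul (v : FirstKind ω hfin m₀ hm₀ j w) :
    D.X • v = actX ω hfin m₀ hm₀ j w v := by
  show actHom ω hfin m₀ hm₀ j w D.X v = _
  rw [actHom, lift_X]

theorem Y_smul (v : FirstKind ω hfin m₀ hm₀ j w) :
    D.Y • v = actY ω hfin m₀ hm₀ j w v := by
  show actHom ω hfin m₀ hm₀ j w D.Y v = _
  rw [actHom, lift_Y]

end FirstKind

end GWAData

end

noncomputable section

open scoped DirectSum Classical

universe u

namespace GWAData

/-! ### The residue fields `R ⧸ 𝔪` -/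

section

variable {R : Type u} [CommRing R]

/-! The module `V(ω, j, w)` is a string module. Choose `s` in the orbit with index `j` and with a
break just before it, and walk along `s, σ(s), σ²(s), …`, counting the breaks passed. The pairs `[𝔪,
e_k]` are then listed without repetition by the positions `a` on this walk at which at most
`w.length` breaks have been passed, and these form an initial interval `0, …, L`. Between
neighbouring positions `a` and `a + 1` there are arrows in both directions if position `a` is not a
break. If it is a break, there is exactly one: `X` forwards if the letter read there is `x`, or `Y`
backwards if it is `y`. All scalars along arrows are units in the residue fields. This description
is given by `exists_pos_eq`, `X_smul_el` and `Y_smul_el_succ`.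

Duality. Passing to the finitistic dual reverses the arrows and exchanges `X` with `Y`, so at a
break it exchanges the two letters. Concretely, the standard bases for `w.sharp` and `w` are paired
diagonally, with scalars `scal` chosen to absorb the factors `t`. Since the orbit is real, the
pairing can be made sesquilinear over each residue field. It is nondegenerate, and every element of
the dual is determined by its values on the finitely many basis vectors, whence
`nonempty_equiv_finDual`.

Forms. A nondegenerate admissible form embeds `V(ω, j, w)` in its dual, hence in `V(ω, j, w.sharp)`.
The two modules have the same length over `R`, so this is an isomorphism
(`surjective_of_injective`). Nonzero matrix entries of an isomorphism and of its inverse propagate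
along the strings, so the strings must match from the first position on. But `w` and `w.sharp`
differ in their first letter, so `w` is empty (`eq_nil_of_equiv_sharp`). Conversely the empty word
equals its own image under the exchange, and the pairing itself is then the required form.

Simplicity. For the empty word all neighbouring positions are joined in both directions, so any
nonzero vector generates everything (`isSimpleModule_nil`). A nonempty word has a one-way arrow at
the first break, which cuts off a proper nonzero submodule (`eq_nil_of_isSimpleModule`). -/

theorem isDomain_quotient (m : MaximalSpectrum R) : IsDomain (R ⧸ m.asIdeal) := by
  have := m.isMaximal
  exact inferInstance

theorem one_quotient_ne_zero (m : MaximalSpectrum R) : (1 : R ⧸ m.asIdeal) ≠ 0 := by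
  have := isDomain_quotient m
  exact one_ne_zero

theorem mk_ne_zero {m : MaximalSpectrum R} {r : R} (h : r ∉ m.asIdeal) :
    Ideal.Quotient.mk m.asIdeal r ≠ 0 := fun h' => h (Ideal.Quotient.eq_zero_iff_mem.1 h')

theorem mul_quotient_ne_zero {m : MaximalSpectrum R} {x y : R ⧸ m.asIdeal} (hx : x ≠ 0)
    (hy : y ≠ 0) : x * y ≠ 0 := by
  have := isDomain_quotient m
  exact mul_ne_zero hx hy

theorem exists_mk_mul_eq_one {m : MaximalSpectrum R} {x : R ⧸ m.asIdeal} (hx : x ≠ 0) :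
    ∃ r, Ideal.Quotient.mk m.asIdeal r * x = 1 := by
  have := m.isMaximal
  obtain ⟨y, hy⟩ := Ideal.Quotient.exists_inv hx
  obtain ⟨r, rfl⟩ := Ideal.Quotient.mk_surjective y
  exact ⟨r, by rw [mul_comm, hy]⟩

/-- The quotient by `m'` is a domain, so an ideal killing a nonzero element lies in `m'`; maximality
does the rest. This is how different weights are told apart. -/
theorem eq_of_quotient_ne_zero {m m' : MaximalSpectrum R} {x : R ⧸ m'.asIdeal} (hx : x ≠ 0)
    (h : ∀ r ∈ m.asIdeal, Ideal.Quotient.mk m'.asIdeal r * x = 0) : m = m' := by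
  have := isDomain_quotient m'
  refine MaximalSpectrum.ext (m.isMaximal.eq_of_le m'.isMaximal.ne_top fun r hr => ?_)
  exact Ideal.Quotient.eq_zero_iff_mem.1 ((mul_eq_zero.1 (h r hr)).resolve_right hx)

end

/-! ### Reduction of `A`-linearity and stability to the generators -/

variable {R : Type u} [CommRing R] [StarRing R] {D : GWAData R}

/-- An induction principle for the elements of `A`. -/
theorem alg_induction {P : D.Alg → Prop} (ofR : ∀ r, P (D.ofR r)) (hX : P D.X) (hY : P D.Y)
    (add : ∀ a b, P a → P b → P (a + b)) (mul : ∀ a b, P a → P b → P (a * b)) (a : D.Alg) :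
    P a := by
  obtain ⟨b, rfl⟩ : ∃ b, D.proj b = a := RingQuot.mkRingHom_surjective D.Rel a
  induction b using FreeAlgebra.induction with
  | grade0 n =>
    -- Integer scalars come from `R`, so they need no hypothesis of their own.
    have h : D.proj (algebraMap ℤ _ n) = D.ofR (n : R) := by simp
    rw [h]
    exact ofR _
  | grade1 g =>
    cases g with
    | coe r => exact ofR r
    | X => exact hX
    | Y => exact hY
  | mul a b ha hb =>
    rw [map_mul]
    exact mul _ _ ha hb
  | add a b ha hb =>
    rw [map_add]
    exact add _ _ ha hb

/-- An additive map is `A`-linear if it commutes with `R`, `X` and `Y`. -/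
def linearMapOfGenerators {V W : Type*} [AddCommGroup V] [Module D.Alg V] [AddCommGroup W]
    [Module D.Alg W] (f : V →+ W) (ofR : ∀ (r : R) v, f (D.ofR r • v) = D.ofR r • f v)
    (hX : ∀ v, f (D.X • v) = D.X • f v) (hY : ∀ v, f (D.Y • v) = D.Y • f v) :
    V →ₗ[D.Alg] W where
  toFun := f
  map_add' := map_add f
  map_smul' a := by
    refine alg_induction (P := fun a => ∀ v, f (a • v) = a • f v) ofR hX hY ?_ ?_ a
    · intro a b ha hb v
      rw [add_smul, add_smul, map_add, ha, hb]
    · intro a b ha hb v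
      rw [mul_smul, mul_smul, ha, hb]

/-- A subgroup stable under `R`, `X` and `Y` is an `A`-submodule. -/
def submoduleOfGenerators {V : Type*} [AddCommGroup V] [Module D.Alg V] (S : AddSubgroup V)
    (ofR : ∀ (r : R), ∀ v ∈ S, D.ofR r • v ∈ S) (hX : ∀ v ∈ S, D.X • v ∈ S)
    (hY : ∀ v ∈ S, D.Y • v ∈ S) : Submodule D.Alg V where
  toAddSubmonoid := S.toAddSubmonoid
  smul_mem' a := by
    refine alg_induction (P := fun a => ∀ {v}, v ∈ S → a • v ∈ S) (fun r v => ofR r v)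
      (fun {v} => hX v) (fun {v} => hY v) ?_ ?_ a
    · intro a b ha hb v hv
      rw [add_smul]
      exact S.add_mem (ha hv) (hb hv)
    · intro a b ha hb v hv
      rw [mul_smul]
      exact ha (hb hv)

/-! ### Walks along a finite orbit and the count of breaks -/

namespace Orbit

variable (ω : D.Orbit)

/-- `𝔪` is a break, for a member `𝔪` of the orbit. -/
def IsBreak (m : ω.carrier) : Prop := D.t ∈ (m : MaximalSpectrum R).asIdeal

/-- The sequence `s, σ(s), σ²(s), …`. -/
def seq (s : ω.carrier) : ℕ → ω.carrier
  | 0 => s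
  | a + 1 => ω.next (seq s a)

/-- The number of breaks among the first `a` members of the sequence `s, σ(s), σ²(s), …`. -/
def cnt (s : ω.carrier) (a : ℕ) : ℕ := Nat.count (fun i => ω.IsBreak (ω.seq s i)) a

variable {ω}

theorem coe_seq (s : ω.carrier) (a : ℕ) :
    (ω.seq s a : MaximalSpectrum R) = (D.σMax ^ a) s := by
  induction a with
  | zero => rfl
  | succ a ih =>
    rw [pow_succ', Equiv.Perm.mul_apply, ← ih]
    rfl

theorem isBreak_iff (m : ω.carrier) : ω.IsBreak m ↔ (m : MaximalSpectrum R) ∈ ω.breaks :=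
  ⟨fun h => ⟨m.2, h⟩, fun h => h.2⟩

theorem cnt_eq (s : ω.carrier) (a : ℕ) :
    ω.cnt s a = Nat.count (fun i => (D.σMax ^ i) (s : MaximalSpectrum R) ∈ ω.breaks) a := by
  simp only [cnt, isBreak_iff, coe_seq]

theorem cnt_zero (s : ω.carrier) : ω.cnt s 0 = 0 := Nat.count_zero _

theorem cnt_succ_of_isBreak {s : ω.carrier} {a : ℕ} (h : ω.IsBreak (ω.seq s a)) :
    ω.cnt s (a + 1) = ω.cnt s a + 1 := by
  rw [cnt, Nat.count_succ, if_pos h]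
  rfl

theorem cnt_succ_of_not_isBreak {s : ω.carrier} {a : ℕ} (h : ¬ ω.IsBreak (ω.seq s a)) :
    ω.cnt s (a + 1) = ω.cnt s a := by
  rw [cnt, Nat.count_succ, if_neg h]
  rfl

theorem cnt_mono (s : ω.carrier) : Monotone (ω.cnt s) := Nat.count_monotone _

theorem seq_add (s : ω.carrier) (a b : ℕ) : ω.seq s (a + b) = ω.seq (ω.seq s a) b := by
  induction b with
  | zero => rfl
  | succ b ih => exact congrArg ω.next ih

theorem cnt_add (s : ω.carrier) (a b : ℕ) :
    ω.cnt s (a + b) = ω.cnt s a + ω.cnt (ω.seq s a) b := by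
  simp only [cnt, Nat.count_add, seq_add]

/-- The minimal period of `σ` at `s` serves: one full turn meets every member of the orbit exactly
once, hence every break once. -/
theorem exists_period (hfin : ω.carrier.Finite) (s : ω.carrier) : ∃ p, 0 < p ∧ ω.seq s p = s ∧
    ω.cnt s p = ω.breaks.ncard ∧ ∀ m, ∃ a < p, ω.seq s a = m := by
  refine ⟨Function.minimalPeriod D.σMax (s : MaximalSpectrum R),
    Function.minimalPeriod_pos_of_mem_periodicPts (ω.mem_periodicPts hfin s.2), ?_, ?_, ?_⟩
  · apply Subtype.ext
    rw [coe_seq, Equiv.Perm.coe_pow]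
    exact Function.isPeriodicPt_minimalPeriod D.σMax _
  · rw [cnt_eq, ω.count_period hfin s.2]
  · intro m
    obtain ⟨a, ha, h⟩ := ω.exists_pow_eq hfin s.2 m.2
    exact ⟨a, ha, Subtype.ext (by rw [coe_seq, h])⟩

theorem seq_period_mul {s : ω.carrier} {p : ℕ} (hp : ω.seq s p = s) (q : ℕ) :
    ω.seq s (q * p) = s ∧ ω.cnt s (q * p) = q * ω.cnt s p := by
  induction q with
  | zero => simp [seq, cnt_zero]
  | succ q ih => rw [add_mul, one_mul, seq_add, cnt_add, ih.1, ih.2, hp]; simp [add_mul]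

theorem ncard_breaks_pos (hfin : ω.carrier.Finite) {m₀ : MaximalSpectrum R}
    (hm₀ : m₀ ∈ ω.breaks) : 0 < ω.breaks.ncard :=
  (Set.ncard_pos (hfin.subset fun _ h => h.1)).2 ⟨m₀, hm₀⟩

theorem infinite_isBreak (hfin : ω.carrier.Finite) {m₀ : MaximalSpectrum R}
    (hm₀ : m₀ ∈ ω.breaks) (s : ω.carrier) : {i | ω.IsBreak (ω.seq s i)}.Infinite := by
  obtain ⟨p, hp, hps, -, h⟩ := ω.exists_period hfin s
  obtain ⟨a, -, ha⟩ := h ⟨m₀, hm₀.1⟩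
  apply Set.infinite_of_injective_forall_mem (f := fun q : ℕ => q * p + a)
  · intro q q' h
    exact Nat.eq_of_mul_eq_mul_right hp (Nat.add_right_cancel h)
  · intro q
    show ω.IsBreak _
    rw [seq_add, (seq_period_mul hps q).1, ha]
    exact hm₀.2

/-- There is a bound for the positions which belong to the first `n + 1` segments. -/
theorem exists_bound (hfin : ω.carrier.Finite) {m₀ : MaximalSpectrum R}
    (hm₀ : m₀ ∈ ω.breaks) (s : ω.carrier) (n : ℕ) :
    ∃ L, ω.IsBreak (ω.seq s L) ∧ ω.cnt s L = n ∧ ∀ a, ω.cnt s a ≤ n ↔ a < L + 1 := by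
  have hinf := infinite_isBreak hfin hm₀ s
  -- `L` is the position of break number `n`, counted from `0`. Since `cnt` counts the breaks
  -- strictly before a position, `L` itself still belongs to segment `n`.
  refine ⟨Nat.nth (fun i => ω.IsBreak (ω.seq s i)) n, Nat.nth_mem_of_infinite hinf n,
    Nat.count_nth_of_infinite hinf n, fun a => ?_⟩
  rw [← not_lt, Nat.lt_succ_iff, ← not_lt]
  exact not_congr (Nat.lt_nth_iff_count_lt hinf)

theorem jIndex_seq (hfin : ω.carrier.Finite) {m₀ : MaximalSpectrum R}
    (hm₀ : m₀ ∈ ω.breaks) (s : ω.carrier) (a : ℕ) :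
    ω.jIndex m₀ (ω.seq s a) = ω.jIndex m₀ s + (ω.cnt s a : ℕ) := by
  induction a with
  | zero => rw [cnt_zero, Nat.cast_zero, add_zero]; rfl
  | succ a ih =>
    rw [seq]
    by_cases h : ω.IsBreak (ω.seq s a)
    · rw [ω.jIndex_next_of_mem hfin hm₀.1 h, ih, cnt_succ_of_isBreak h]
      push_cast
      ring
    · rw [ω.jIndex_next_of_notMem hfin hm₀.1 h, ih, cnt_succ_of_not_isBreak h]

theorem exists_start (hfin : ω.carrier.Finite) {m₀ : MaximalSpectrum R}
    (hm₀ : m₀ ∈ ω.breaks) (j : ZMod ω.breaks.ncard) :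
    ∃ s : ω.carrier, ω.IsBreak (ω.prev s) ∧ ω.jIndex m₀ s = j := by
  have : NeZero ω.breaks.ncard := ⟨(ncard_breaks_pos hfin hm₀).ne'⟩
  -- The start is the successor of the break with index `j - 1`; stepping over that break raises the
  -- index to `j`.
  obtain ⟨L, hL, hc, -⟩ := exists_bound hfin hm₀ ⟨m₀, hm₀.1⟩ (j - 1).val
  refine ⟨ω.next (ω.seq ⟨m₀, hm₀.1⟩ L), by rwa [ω.prev_next], ?_⟩
  rw [ω.jIndex_next_of_mem hfin hm₀.1 hL, jIndex_seq hfin hm₀, ω.jIndex_self, hc,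
    ZMod.natCast_zmod_val]
  ring

/-- Otherwise there is a closed walk of positive length `d` that meets no break. Repeated `L + 1`
times it still meets none, although the first break comes at position `L`. -/
theorem eq_of_seq_eq_of_cnt_eq (hfin : ω.carrier.Finite) {m₀ : MaximalSpectrum R}
    (hm₀ : m₀ ∈ ω.breaks) {s : ω.carrier} {a b : ℕ} (h : ω.seq s a = ω.seq s b)
    (hc : ω.cnt s a = ω.cnt s b) : a = b := by
  wlog hab : a ≤ b generalizing a b
  · exact (this h.symm hc.symm (Nat.le_of_not_le hab)).symm
  obtain ⟨d, rfl⟩ := Nat.exists_eq_add_of_le hab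
  rw [seq_add] at h
  rw [cnt_add] at hc
  rcases Nat.eq_zero_or_pos d with rfl | hd
  · rfl
  obtain ⟨L, -, hL, hL'⟩ := exists_bound hfin hm₀ (ω.seq s a) 0
  have h1 := (seq_period_mul h.symm (L + 1)).2
  rw [show ω.cnt (ω.seq s a) d = 0 by omega, mul_zero] at h1
  have h2 := (hL' _).1 h1.le
  have := Nat.le_mul_of_pos_right (L + 1) hd
  omega

/-- The position is reached by `k / ω.breaks.ncard` full turns followed by the part of a turn that
leads to `m`; the condition on the index says that this part passes `k % ω.breaks.ncard` breaks. -/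
theorem exists_seq_eq_cnt_eq (hfin : ω.carrier.Finite) {m₀ : MaximalSpectrum R}
    (hm₀ : m₀ ∈ ω.breaks) {s : ω.carrier} (hs : ω.IsBreak (ω.prev s)) (m : ω.carrier) (k : ℕ)
    (h : ω.jIndex m₀ s + (k : ZMod ω.breaks.ncard) = ω.jIndex m₀ m) :
    ∃ a, ω.seq s a = m ∧ ω.cnt s a = k := by
  obtain ⟨p, hp, hps, hpc, hex⟩ := ω.exists_period hfin s
  obtain ⟨i, hi, rfl⟩ := hex m
  obtain ⟨p, rfl⟩ := Nat.exists_eq_add_of_le' hp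
  have hb : ω.IsBreak (ω.seq s p) := by
    have : ω.prev (ω.seq s (p + 1)) = ω.seq s p := ω.prev_next _
    rwa [← this, hps]
  -- The last member of a turn is the break before `s`, so before it fewer than all breaks have been
  -- passed. This makes the count at `i` the actual remainder of `k`.
  have hlt : ω.cnt s i < ω.breaks.ncard := by
    have h1 := cnt_mono s (Nat.lt_succ_iff.1 hi)
    rw [cnt_succ_of_isBreak hb] at hpc
    omega
  rw [jIndex_seq hfin hm₀] at h
  have h' := (ZMod.natCast_eq_natCast_iff' _ _ _).1 (add_left_cancel h)
  rw [Nat.mod_eq_of_lt hlt] at h'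
  obtain ⟨h1, h2⟩ := seq_period_mul hps (k / ω.breaks.ncard)
  refine ⟨k / ω.breaks.ncard * (p + 1) + i, by rw [seq_add, h1], ?_⟩
  rw [cnt_add, h1, h2, hpc, ← h']
  exact Nat.div_add_mod' _ _

end Orbit

/-! ### Residue maps along `σ` and the arrows of a string -/

theorem quotσ_mk (m : MaximalSpectrum R) (r : R) :
    D.quotσ m (Ideal.Quotient.mk _ r) = Ideal.Quotient.mk _ (D.σ r) := rfl

theorem quotσ_eq_zero {m : MaximalSpectrum R} {x : R ⧸ m.asIdeal} :
    D.quotσ m x = 0 ↔ x = 0 := by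
  obtain ⟨r, rfl⟩ := Ideal.Quotient.mk_surjective x
  rw [quotσ_mk, Ideal.Quotient.eq_zero_iff_mem, Ideal.Quotient.eq_zero_iff_mem, mem_σMax,
    RingEquiv.symm_apply_apply]

namespace Orbit

variable {ω : D.Orbit} (s : ω.carrier) (w : Word)

/-- The letter `x` can be read at position `a` of the string described by `s` and `w`. -/
def HasX (a : ℕ) : Prop := ω.IsBreak (ω.seq s a) → w[ω.cnt s a]? = some Letter.x

/-- The letter `y` can be read at position `a` of the string described by `s` and `w`. -/
def HasY (a : ℕ) : Prop := ω.IsBreak (ω.seq s a) → w[ω.cnt s a]? = some Letter.y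

/-- The scalar which occurs in the action of `X` on the basis vector at position `a`. -/
def tau (a : ℕ) : R := if ω.IsBreak (ω.seq s a) then 1 else D.t

variable {s w}

theorem tau_notMem (a : ℕ) : tau s a ∉ (ω.seq s a : MaximalSpectrum R).asIdeal := by
  rw [tau]
  split_ifs with h
  · exact (Ideal.ne_top_iff_one _).1 (ω.seq s a : MaximalSpectrum R).isMaximal.ne_top
  · exact h

theorem star_tau (a : ℕ) : star (tau s a) = tau s a := by
  rw [tau]
  split_ifs
  · exact star_one R
  · exact D.t_star

theorem hasX_sharp {a : ℕ} : HasX s w.sharp a ↔ HasY s w a := by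
  refine imp_congr_right fun _ => ?_
  rw [Word.sharp, List.getElem?_map]
  rcases w[ω.cnt s a]? with _ | _ | _ <;> simp [Letter.swap]

theorem hasY_sharp {a : ℕ} : HasY s w.sharp a ↔ HasX s w a := by
  refine imp_congr_right fun _ => ?_
  rw [Word.sharp, List.getElem?_map]
  rcases w[ω.cnt s a]? with _ | _ | _ <;> simp [Letter.swap]

/-- Neighbouring positions of a string are always joined by an arrow: away from breaks both
predicates hold vacuously, and at a break the letter is one of the two. This connectedness carries
the propagation in `EntryNeZero.succ`. -/
theorem hasX_or_hasY {a : ℕ} (h : ω.cnt s (a + 1) ≤ w.length) : HasX s w a ∨ HasY s w a := by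
  by_cases hb : ω.IsBreak (ω.seq s a)
  · rw [cnt_succ_of_isBreak hb] at h
    rw [HasX, HasY, List.getElem?_eq_getElem h]
    rcases w[ω.cnt s a] with _ | _ <;> simp [hb]
  · exact Or.inl fun h => (hb h).elim

/-- At a break a letter must exist in order to be read, so an arrow never leaves the string at its
end. -/
theorem cnt_le_of_hasX {a : ℕ} (hx : HasX s w a) (h : ω.cnt s a ≤ w.length) :
    ω.cnt s (a + 1) ≤ w.length := by
  by_cases hb : ω.IsBreak (ω.seq s a)
  · rw [cnt_succ_of_isBreak hb]
    exact (List.getElem?_eq_some_iff.1 (hx hb)).1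
  · rwa [cnt_succ_of_not_isBreak hb]

theorem cnt_le_of_hasY {a : ℕ} (hy : HasY s w a) (h : ω.cnt s a ≤ w.length) :
    ω.cnt s (a + 1) ≤ w.length := by
  by_cases hb : ω.IsBreak (ω.seq s a)
  · rw [cnt_succ_of_isBreak hb]
    exact (List.getElem?_eq_some_iff.1 (hy hb)).1
  · rwa [cnt_succ_of_not_isBreak hb]

end Orbit

open Orbit

/-- The map `R/𝔪 → R/σ(𝔪)` for the member `𝔪` of a sequence `s, σ(s), σ²(s), …`. -/
def Orbit.shift {ω : D.Orbit} (s : ω.carrier) (a : ℕ) :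
    R ⧸ (ω.seq s a : MaximalSpectrum R).asIdeal →+*
      R ⧸ (ω.seq s (a + 1) : MaximalSpectrum R).asIdeal :=
  D.quotσ _

theorem Orbit.shift_mk {ω : D.Orbit} (s : ω.carrier) (a : ℕ) (r : R) :
    shift s a (Ideal.Quotient.mk _ r) = Ideal.Quotient.mk _ (D.σ r) := rfl

theorem Orbit.shift_eq_zero {ω : D.Orbit} {s : ω.carrier} {a : ℕ}
    {x : R ⧸ (ω.seq s a : MaximalSpectrum R).asIdeal} : shift s a x = 0 ↔ x = 0 :=
  quotσ_eq_zero

/-! ### String coordinates on `V(ω, j, w)` -/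

namespace FirstKind

variable {ω : D.Orbit} (hfin : ω.carrier.Finite) {m₀ : MaximalSpectrum R} (hm₀ : m₀ ∈ ω.breaks)
  (s : ω.carrier) (w : Word)

/-- The pair `[𝔪, e_k]` at position `a` of the string which starts with `[s, e_0]`. -/
def pos {s : ω.carrier} {w : Word} {a : ℕ} (h : ω.cnt s a ≤ w.length) :
    FirstKindIndex ω m₀ (ω.jIndex m₀ s) w :=
  ⟨(ω.seq s a, ⟨ω.cnt s a, Nat.lt_succ_of_le h⟩), (jIndex_seq hfin hm₀ s a).symm⟩

/-- The map `λ ↦ λ [𝔪, e_k]`, where `[𝔪, e_k]` is the pair at position `a`, if there is one. -/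
def elOfLe {s : ω.carrier} {w : Word} {a : ℕ} (h : ω.cnt s a ≤ w.length) :
    R ⧸ (ω.seq s a : MaximalSpectrum R).asIdeal →+
      FirstKind ω hfin m₀ hm₀ (ω.jIndex m₀ s) w :=
  basis hfin hm₀ (pos hfin hm₀ h)

/-- The coefficient of the pair at position `a`, if there is one. -/
def coefOfLe {s : ω.carrier} {w : Word} {a : ℕ} (h : ω.cnt s a ≤ w.length) :
    FirstKind ω hfin m₀ hm₀ (ω.jIndex m₀ s) w →+
      R ⧸ (ω.seq s a : MaximalSpectrum R).asIdeal :=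
  DFinsupp.evalAddMonoidHom
    (β := fun b : FirstKindIndex ω m₀ (ω.jIndex m₀ s) w =>
      R ⧸ (b.1.1 : MaximalSpectrum R).asIdeal) (pos hfin hm₀ h)

/-- The map `λ ↦ λ [𝔪, e_k]`, where `[𝔪, e_k]` is the pair at position `a`. -/
def el (a : ℕ) : R ⧸ (ω.seq s a : MaximalSpectrum R).asIdeal →+
    FirstKind ω hfin m₀ hm₀ (ω.jIndex m₀ s) w :=
  -- The value zero beyond the end of the string lets the formulas for the action hold at every
  -- position.
  if h : ω.cnt s a ≤ w.length then elOfLe hfin hm₀ h else 0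

variable {hfin hm₀} {w}

/-- The coefficient of the pair at position `a`. -/
def coef (a : ℕ) : FirstKind ω hfin m₀ hm₀ (ω.jIndex m₀ s) w →+
    R ⧸ (ω.seq s a : MaximalSpectrum R).asIdeal :=
  if h : ω.cnt s a ≤ w.length then coefOfLe hfin hm₀ h else 0

variable (hfin hm₀) {s}

theorem el_of_le {a : ℕ} (h : ω.cnt s a ≤ w.length) :
    el hfin hm₀ s w a = elOfLe hfin hm₀ h := dif_pos h

theorem el_mk {a : ℕ} (h : ω.cnt s a ≤ w.length) (r : R) :
    el hfin hm₀ s w a (Ideal.Quotient.mk _ r) =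
      basis hfin hm₀ (pos hfin hm₀ h) (Ideal.Quotient.mk _ r) :=
  DFunLike.congr_fun (el_of_le hfin hm₀ h) _

theorem el_of_lt {a : ℕ} (h : w.length < ω.cnt s a) : el hfin hm₀ s w a = 0 :=
  dif_neg (not_le.2 h)

theorem pos_injective {a b : ℕ} {ha : ω.cnt s a ≤ w.length} {hb : ω.cnt s b ≤ w.length}
    (h : pos hfin hm₀ ha = pos hfin hm₀ hb) : a = b :=
  eq_of_seq_eq_of_cnt_eq hfin hm₀ (congrArg (fun b => b.1.1) h)
    (congrArg (fun b => (b.1.2 : ℕ)) h)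

/-- With `pos_injective` this identifies the pairs `[𝔪, e_k]` with an interval of positions. The
break before `s` is needed: otherwise the members of the segment of `s` lying before `s` would be
missed for `k = 0`. -/
theorem exists_pos_eq (hs : ω.IsBreak (ω.prev s))
    (b : FirstKindIndex ω m₀ (ω.jIndex m₀ s) w) :
    ∃ (a : ℕ) (h : ω.cnt s a ≤ w.length), pos hfin hm₀ h = b := by
  obtain ⟨⟨m, k⟩, hb⟩ := b
  obtain ⟨a, rfl, hk⟩ := exists_seq_eq_cnt_eq hfin hm₀ hs m k hb
  exact ⟨a, hk.trans_le (Nat.le_of_lt_succ k.2), Subtype.ext (Prod.ext rfl (Fin.ext hk))⟩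

theorem coef_el_self {a : ℕ} (h : ω.cnt s a ≤ w.length)
    (x : R ⧸ (ω.seq s a : MaximalSpectrum R).asIdeal) :
    coef s a (el hfin hm₀ s w a x) = x := by
  rw [el_of_le hfin hm₀ h, coef, dif_pos h]
  exact DFinsupp.single_eq_same (β := fun b : FirstKindIndex ω m₀ (ω.jIndex m₀ s) w =>
    R ⧸ (b.1.1 : MaximalSpectrum R).asIdeal)

theorem coef_el_of_ne {a b : ℕ} (h : a ≠ b) (x : R ⧸ (ω.seq s a : MaximalSpectrum R).asIdeal) :
    coef s b (el hfin hm₀ s w a x) = 0 := by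
  rw [el, coef]
  split_ifs with hb ha
  · exact DFinsupp.single_eq_of_ne (β := fun b : FirstKindIndex ω m₀ (ω.jIndex m₀ s) w =>
      R ⧸ (b.1.1 : MaximalSpectrum R).asIdeal) fun he => h (pos_injective hfin hm₀ he).symm
  · exact map_zero _
  all_goals rfl

theorem coef_of_lt {a : ℕ} (h : w.length < ω.cnt s a)
    (v : FirstKind ω hfin m₀ hm₀ (ω.jIndex m₀ s) w) : coef s a v = 0 := by
  rw [coef, dif_neg (not_le.2 h)]
  rfl

variable {hfin hm₀}

theorem el_hom_ext (hs : ω.IsBreak (ω.prev s)) {M : Type*} [AddMonoid M]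
    {f g : FirstKind ω hfin m₀ hm₀ (ω.jIndex m₀ s) w →+ M}
    (h : ∀ a, ω.cnt s a ≤ w.length → ∀ r, f (el hfin hm₀ s w a (Ideal.Quotient.mk _ r)) =
      g (el hfin hm₀ s w a (Ideal.Quotient.mk _ r))) : f = g := by
  apply hom_ext
  intro b r
  obtain ⟨a, ha, rfl⟩ := exists_pos_eq hfin hm₀ hs b
  have := h a ha r
  rwa [el_mk hfin hm₀ ha] at this

theorem ext_coef (hs : ω.IsBreak (ω.prev s))
    {v v' : FirstKind ω hfin m₀ hm₀ (ω.jIndex m₀ s) w}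
    (h : ∀ a, ω.cnt s a ≤ w.length → coef s a v = coef s a v') : v = v' := by
  refine DFinsupp.ext (β := fun b : FirstKindIndex ω m₀ (ω.jIndex m₀ s) w =>
    R ⧸ (b.1.1 : MaximalSpectrum R).asIdeal) fun b => ?_
  obtain ⟨a, ha, rfl⟩ := exists_pos_eq hfin hm₀ hs b
  have := h a ha
  rw [coef, dif_pos ha] at this
  exact this

theorem smul_el (r : R) (a : ℕ) (q : R) :
    D.ofR r • el hfin hm₀ s w a (Ideal.Quotient.mk _ q) =
      el hfin hm₀ s w a (Ideal.Quotient.mk _ (r * q)) := by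
  by_cases h : ω.cnt s a ≤ w.length
  · rw [el_mk hfin hm₀ h, el_mk hfin hm₀ h, ofR_smul, smul_basis]
  · rw [el_of_lt hfin hm₀ (not_le.1 h)]
    exact smul_zero _

theorem X_smul_el (a : ℕ) (r : R) :
    D.X • el hfin hm₀ s w a (Ideal.Quotient.mk _ r) =
      if HasX s w a then el hfin hm₀ s w (a + 1) (Ideal.Quotient.mk _ (D.σ (tau s a * r)))
      else 0 := by
  by_cases ha : ω.cnt s a ≤ w.length
  · rw [el_mk hfin hm₀ ha, FirstKind.X_smul]
    by_cases hb : ω.IsBreak (ω.seq s a)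
    · by_cases hz : w[ω.cnt s a]? = some Letter.x
      · have hx : HasX s w a := fun _ => hz
        rw [if_pos hx, actX_basis_of_mem _ _ (pos hfin hm₀ ha) hb hz,
          el_mk hfin hm₀ (cnt_le_of_hasX hx ha),
          tau, if_pos hb, one_mul]
        refine basis_congr hfin hm₀ (Subtype.ext ?_) _
        exact Prod.ext rfl (Fin.ext (cnt_succ_of_isBreak hb).symm)
      · rw [if_neg fun hx : HasX s w a => hz (hx hb), 
          actX_basis_eq_zero _ _ (pos hfin hm₀ ha) hb hz]
    · have hx : HasX s w a := fun h => (hb h).elim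
      rw [if_pos hx, actX_basis_of_notMem _ _ (pos hfin hm₀ ha) hb,
        el_mk hfin hm₀ (cnt_le_of_hasX hx ha),
        tau, if_neg hb]
      refine basis_congr hfin hm₀ (Subtype.ext ?_) _
      exact Prod.ext rfl (Fin.ext (cnt_succ_of_not_isBreak hb).symm)
  · have ha' : w.length < ω.cnt s (a + 1) := (not_le.1 ha).trans_le (cnt_mono s a.le_succ)
    rw [el_of_lt hfin hm₀ (not_le.1 ha), el_of_lt hfin hm₀ ha']
    simp

/-- Position `0` lies just after a break and has `k = 0`, so no letter stands to its left. -/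
theorem Y_smul_el_zero (hs : ω.IsBreak (ω.prev s)) (r : R) :
    D.Y • el hfin hm₀ s w 0 (Ideal.Quotient.mk _ r) = 0 := by
  have h0 : ω.cnt s 0 ≤ w.length := (cnt_zero s).trans_le (Nat.zero_le _)
  rw [el_mk hfin hm₀ h0, FirstKind.Y_smul, actY_basis_eq_zero _ _ (pos hfin hm₀ h0) hs]
  rintro ⟨h, -⟩
  exact absurd (h.trans_eq (cnt_zero s)) (by simp)

theorem Y_smul_el_succ (a : ℕ) (r : R) :
    D.Y • el hfin hm₀ s w (a + 1) (Ideal.Quotient.mk _ r) =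
      if HasY s w a then el hfin hm₀ s w a (Ideal.Quotient.mk _ (D.σ.symm r)) else 0 := by
  have hprev : ω.prev (ω.seq s (a + 1)) = ω.seq s a := ω.prev_next _
  by_cases ha : ω.cnt s (a + 1) ≤ w.length
  · have ha' : ω.cnt s a ≤ w.length := (cnt_mono s a.le_succ).trans ha
    rw [el_mk hfin hm₀ ha, el_mk hfin hm₀ ha', FirstKind.Y_smul]
    by_cases hb : ω.IsBreak (ω.seq s a)
    · have hb' : D.t ∈ (ω.prev (pos hfin hm₀ ha).1.1 : MaximalSpectrum R).asIdeal := by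
        show ω.IsBreak (ω.prev (ω.seq s (a + 1)))
        rwa [hprev]
      have hc := cnt_succ_of_isBreak hb
      by_cases hz : w[ω.cnt s a]? = some Letter.y
      · have hy : HasY s w a := fun _ => hz
        rw [if_pos hy, actY_basis_of_mem _ _ _ hb']
        · refine basis_congr hfin hm₀ (Subtype.ext (Prod.ext hprev (Fin.ext ?_))) _
          show ω.cnt s (a + 1) - 1 = ω.cnt s a
          rw [hc, Nat.add_sub_cancel]
        · show 1 ≤ ω.cnt s (a + 1) ∧ w[ω.cnt s (a + 1) - 1]? = _
          rw [hc, Nat.add_sub_cancel]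
          exact ⟨Nat.le_add_left _ _, hz⟩
      · rw [if_neg fun hy : HasY s w a => hz (hy hb), actY_basis_eq_zero _ _ _ hb']
        show ¬ (1 ≤ ω.cnt s (a + 1) ∧ w[ω.cnt s (a + 1) - 1]? = _)
        rw [hc, Nat.add_sub_cancel]
        exact fun h => hz h.2
    · have hb' : D.t ∉ (ω.prev (pos hfin hm₀ ha).1.1 : MaximalSpectrum R).asIdeal := by
        show ¬ ω.IsBreak (ω.prev (ω.seq s (a + 1)))
        rwa [hprev]
      have hy : HasY s w a := fun h => (hb h).elim
      rw [if_pos hy, actY_basis_of_notMem _ _ _ hb']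
      exact basis_congr hfin hm₀ (Subtype.ext (Prod.ext hprev (Fin.ext
        (cnt_succ_of_not_isBreak hb)))) _
  · rw [el_of_lt hfin hm₀ (not_le.1 ha), AddMonoidHom.zero_apply, smul_zero]
    split_ifs with hy
    · rw [el_of_lt hfin hm₀ (not_le.1 fun h => ha (cnt_le_of_hasY hy h))]
      rfl
    · rfl

theorem coef_smul (hs : ω.IsBreak (ω.prev s)) (a : ℕ) (r : R) (v : FirstKind ω hfin m₀ hm₀ (ω.jIndex m₀ s) w) :
    coef s a (D.ofR r • v) = Ideal.Quotient.mk _ r * coef s a v := by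
  have key : (coef s a).comp (act (FirstKind ω hfin m₀ hm₀ (ω.jIndex m₀ s) w) (D.ofR r)) =
      (AddMonoidHom.mulLeft (Ideal.Quotient.mk _ r)).comp (coef s a) := by
    apply el_hom_ext hs
    intro b hb q
    show coef s a (D.ofR r • el hfin hm₀ s w b _) = Ideal.Quotient.mk _ r * coef s a _
    rw [smul_el]
    by_cases h : a = b
    · subst h
      rw [coef_el_self hfin hm₀ hb, coef_el_self hfin hm₀ hb, map_mul]
    · rw [coef_el_of_ne hfin hm₀ (Ne.symm h), coef_el_of_ne hfin hm₀ (Ne.symm h), mul_zero]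
  exact DFunLike.congr_fun key v

theorem coef_zero_X_smul (hs : ω.IsBreak (ω.prev s))
    (v : FirstKind ω hfin m₀ hm₀ (ω.jIndex m₀ s) w) : coef s 0 (D.X • v) = 0 := by
  have key : (coef s 0).comp (act (FirstKind ω hfin m₀ hm₀ (ω.jIndex m₀ s) w) D.X) =
      (0 : FirstKind ω hfin m₀ hm₀ (ω.jIndex m₀ s) w →+ _) := by
    apply el_hom_ext hs
    intro a _ r
    show coef s 0 (D.X • el hfin hm₀ s w a _) = 0
    rw [X_smul_el]
    split_ifs
    · exact coef_el_of_ne hfin hm₀ a.succ_ne_zero _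
    · exact map_zero _
  exact DFunLike.congr_fun key v

theorem coef_succ_X_smul (hs : ω.IsBreak (ω.prev s)) (a : ℕ)
    (v : FirstKind ω hfin m₀ hm₀ (ω.jIndex m₀ s) w) :
    coef s (a + 1) (D.X • v) =
      if HasX s w a then shift s a (Ideal.Quotient.mk _ (tau s a) * coef s a v) else 0 := by
  have key : (coef s (a + 1)).comp (act (FirstKind ω hfin m₀ hm₀ (ω.jIndex m₀ s) w) D.X) =
      if HasX s w a then (shift s a).toAddMonoidHom.comp
        ((AddMonoidHom.mulLeft (Ideal.Quotient.mk _ (tau s a))).comp (coef s a)) else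
      (0 : FirstKind ω hfin m₀ hm₀ (ω.jIndex m₀ s) w →+ _) := by
    apply el_hom_ext hs
    intro b hb r
    show coef s (a + 1) (D.X • el hfin hm₀ s w b _) = _
    rw [X_smul_el]
    by_cases h : a = b
    · subst h
      split_ifs with hx
      · rw [coef_el_self hfin hm₀ (cnt_le_of_hasX hx hb)]
        show _ = shift s a (Ideal.Quotient.mk _ (tau s a) * coef s a (el hfin hm₀ s w a _))
        rw [coef_el_self hfin hm₀ hb]
        rfl
      · exact map_zero _
    · trans 0
      · split_ifs
        · exact coef_el_of_ne hfin hm₀ (fun h' => h (Nat.succ_injective h').symm) _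
        · exact map_zero _
      · split_ifs
        · show _ = shift s a (Ideal.Quotient.mk _ (tau s a) * coef s a (el hfin hm₀ s w b _))
          rw [coef_el_of_ne hfin hm₀ (Ne.symm h), mul_zero, map_zero]
        · rfl
  refine (DFunLike.congr_fun key v).trans ?_
  split_ifs <;> rfl

/-- Applying `shift` puts both sides in the residue field at position `a + 1`, which avoids
transport along `σ⁻¹(σ(𝔪)) = 𝔪`. Nothing is lost, by `shift_eq_zero`. -/
theorem shift_coef_Y_smul (hs : ω.IsBreak (ω.prev s)) (a : ℕ)
    (v : FirstKind ω hfin m₀ hm₀ (ω.jIndex m₀ s) w) :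
    shift s a (coef s a (D.Y • v)) = if HasY s w a then coef s (a + 1) v else 0 := by
  have key : (shift s a).toAddMonoidHom.comp ((coef s a).comp (act (FirstKind ω hfin m₀ hm₀ (ω.jIndex m₀ s) w) D.Y)) =
      if HasY s w a then coef s (a + 1) else
      (0 : FirstKind ω hfin m₀ hm₀ (ω.jIndex m₀ s) w →+ _) := by
    apply el_hom_ext hs
    intro b hb r
    show shift s a (coef s a (D.Y • el hfin hm₀ s w b _)) = _
    rcases b with _ | b
    · rw [Y_smul_el_zero hs, map_zero, map_zero]
      split_ifs
      · exact (coef_el_of_ne hfin hm₀ a.succ_ne_zero.symm _).symm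
      · rfl
    rw [Y_smul_el_succ]
    by_cases h : a = b
    · subst h
      split_ifs with hy
      · rw [coef_el_self hfin hm₀ hb, coef_el_self hfin hm₀ ((cnt_mono s a.le_succ).trans hb),
          shift_mk, RingEquiv.apply_symm_apply]
      · rw [map_zero, map_zero]
        rfl
    · trans 0
      · split_ifs
        · rw [coef_el_of_ne hfin hm₀ (Ne.symm h), map_zero]
        · rw [map_zero, map_zero]
      · split_ifs
        · exact (coef_el_of_ne hfin hm₀ (fun h' => h (Nat.succ_injective h').symm) _).symm
        · rfl
  refine (DFunLike.congr_fun key v).trans ?_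
  split_ifs <;> rfl

end FirstKind

/-! ### Involutions of the residue fields, components of `R_ω`, and rescaling -/

namespace Orbit

variable {ω : D.Orbit}

/-- The involution of `R/𝔪` induced by that of `R`, for a member `𝔪` of a real orbit. -/
def IsReal.starQuot (hreal : ω.IsReal) (m : ω.carrier) :
    R ⧸ (m : MaximalSpectrum R).asIdeal →+* R ⧸ (m : MaximalSpectrum R).asIdeal :=
  Ideal.quotientMap _ (starRingEnd R) fun r hr => (hreal m m.2 r).2 hr

theorem IsReal.starQuot_mk (hreal : ω.IsReal) (m : ω.carrier) (r : R) :
    hreal.starQuot m (Ideal.Quotient.mk _ r) = Ideal.Quotient.mk _ (star r) := rfl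

theorem IsReal.starQuot_ne_zero (hreal : ω.IsReal) {m : ω.carrier}
    {x : R ⧸ (m : MaximalSpectrum R).asIdeal} (hx : x ≠ 0) : hreal.starQuot m x ≠ 0 := by
  obtain ⟨r, rfl⟩ := Ideal.Quotient.mk_surjective x
  rw [starQuot_mk]
  refine mk_ne_zero fun h => hx ?_
  exact Ideal.Quotient.eq_zero_iff_mem.2 ((hreal m m.2 r).1 h)

theorem smul_of_apply (m : ω.carrier) (r : R) (x : R ⧸ (m : MaximalSpectrum R).asIdeal) :
    r • (DirectSum.of _ m x : ω.Rω) = DirectSum.of _ m (Ideal.Quotient.mk _ r * x) := by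
  obtain ⟨q, rfl⟩ := Ideal.Quotient.mk_surjective x
  rw [smul_of, map_mul]

/-- A nonzero component at another member `m'` would be killed by `m` as well, which forces `m =
m'`. -/
theorem eq_of_apply_of_smul_eq_zero {m : ω.carrier} {x : ω.Rω}
    (h : ∀ r ∈ (m : MaximalSpectrum R).asIdeal, r • x = 0) :
    x = DirectSum.of (fun m : ω.carrier => R ⧸ (m : MaximalSpectrum R).asIdeal) m (x m) := by
  refine DFinsupp.ext fun m' => ?_
  by_cases hm : m' = m
  · subst hm
    exact (DirectSum.of_eq_same
      (β := fun m : ω.carrier => R ⧸ (m : MaximalSpectrum R).asIdeal) _ _).symm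
  · rw [DirectSum.of_eq_of_ne
      (β := fun m : ω.carrier => R ⧸ (m : MaximalSpectrum R).asIdeal) _ _ _ hm]
    by_contra hx
    refine hm (Subtype.ext (eq_of_quotient_ne_zero hx fun r hr => ?_).symm)
    have h' := DFunLike.congr_fun (h r hr) m'
    obtain ⟨q, hq⟩ := Ideal.Quotient.mk_surjective (x m')
    rw [DirectSum.smul_apply] at h'
    rw [← hq] at h' ⊢
    exact h'

/-- An inverse modulo `𝔪` of the scalar which occurs in the action of `X`. -/
def tauInv (s : ω.carrier) (a : ℕ) : R :=
  (exists_mk_mul_eq_one (mk_ne_zero (tau_notMem (s := s) a))).choose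

theorem mk_tauInv_mul (s : ω.carrier) (a : ℕ) :
    Ideal.Quotient.mk (ω.seq s a : MaximalSpectrum R).asIdeal (tauInv s a) *
      Ideal.Quotient.mk _ (tau s a) = 1 :=
  (exists_mk_mul_eq_one (mk_ne_zero (tau_notMem (s := s) a))).choose_spec

/-- The scalars by which the dual of the standard basis has to be rescaled. -/
def scal (s : ω.carrier) : ℕ → R
  | 0 => 1
  | a + 1 => D.σ (scal s a * tauInv s a)

/-- This recursion is exactly the condition that makes the diagonal pairing compatible with `X` and
with `Y`. -/
theorem mk_scal_succ_mul (s : ω.carrier) (a : ℕ) :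
    Ideal.Quotient.mk (ω.seq s (a + 1) : MaximalSpectrum R).asIdeal (scal s (a + 1)) *
      Ideal.Quotient.mk _ (D.σ (tau s a)) = Ideal.Quotient.mk _ (D.σ (scal s a)) := by
  rw [scal, ← shift_mk, ← shift_mk, ← shift_mk, ← map_mul, map_mul (Ideal.Quotient.mk _),
    mul_assoc, mk_tauInv_mul, mul_one]

theorem mk_scal_ne_zero (s : ω.carrier) (a : ℕ) :
    Ideal.Quotient.mk (ω.seq s a : MaximalSpectrum R).asIdeal (scal s a) ≠ 0 := by
  induction a with
  | zero =>
    rw [scal, map_one]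
    exact one_quotient_ne_zero _
  | succ a ih =>
    intro h
    have h' := mk_scal_succ_mul s a
    rw [h, zero_mul, ← shift_mk] at h'
    exact ih (shift_eq_zero.1 h'.symm)

end Orbit

open Orbit

/-! ### Expansions in string coordinates, and the duality -/

namespace FirstKind

variable {ω : D.Orbit} {hfin : ω.carrier.Finite} {m₀ : MaximalSpectrum R} {hm₀ : m₀ ∈ ω.breaks}
  {s : ω.carrier} {w : Word}

theorem el_hom_ext₂ (hs : ω.IsBreak (ω.prev s)) {w' : Word} {M : Type*} [AddCommMonoid M]
    {f g : FirstKind ω hfin m₀ hm₀ (ω.jIndex m₀ s) w' →+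
      FirstKind ω hfin m₀ hm₀ (ω.jIndex m₀ s) w →+ M}
    (h : ∀ a b, ω.cnt s a ≤ w'.length → ω.cnt s b ≤ w.length → ∀ q r,
      f (el hfin hm₀ s w' a (Ideal.Quotient.mk _ q)) (el hfin hm₀ s w b (Ideal.Quotient.mk _ r)) =
      g (el hfin hm₀ s w' a (Ideal.Quotient.mk _ q)) (el hfin hm₀ s w b (Ideal.Quotient.mk _ r))) :
    f = g :=
  el_hom_ext hs fun a ha q => el_hom_ext hs fun b hb r => h a b ha hb q r

theorem eq_sum_el (hs : ω.IsBreak (ω.prev s)) {N : ℕ} (hN : ∀ a, ω.cnt s a ≤ w.length ↔ a < N)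
    (v : FirstKind ω hfin m₀ hm₀ (ω.jIndex m₀ s) w) :
    v = ∑ a ∈ Finset.range N, el hfin hm₀ s w a (coef s a v) := by
  refine ext_coef hs fun a ha => ?_
  rw [map_sum, Finset.sum_eq_single a, coef_el_self hfin hm₀ ha]
  · exact fun b _ hb => coef_el_of_ne hfin hm₀ hb _
  · exact fun h => (h (Finset.mem_range.2 ((hN a).1 ha))).elim

theorem exists_coef_ne_zero (hs : ω.IsBreak (ω.prev s))
    {v : FirstKind ω hfin m₀ hm₀ (ω.jIndex m₀ s) w} (hv : v ≠ 0) :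
    ∃ a, ω.cnt s a ≤ w.length ∧ coef s a v ≠ 0 := by
  by_contra! h
  exact hv (ext_coef hs fun a ha => (h a ha).trans (map_zero _).symm)

/-! ### The pairing of `V(ω, j, w^♯)` and `V(ω, j, w)` -/

variable (hfin hm₀ s w) in
/-- The sesquilinear pairing `V(ω, j, w^♯) × V(ω, j, w) → R_ω` for which the standard bases are
dual to each other up to the scalars `scal`. -/
def pairing (hreal : ω.IsReal) (N : ℕ) : FirstKind ω hfin m₀ hm₀ (ω.jIndex m₀ s) w.sharp →+
    FirstKind ω hfin m₀ hm₀ (ω.jIndex m₀ s) w →+ ω.Rω :=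
  ∑ a ∈ Finset.range N,
    ((AddMonoidHom.mul.comp ((AddMonoidHom.mulLeft (Ideal.Quotient.mk _ (scal s a))).comp
      (coef s a))).compl₂ ((hreal.starQuot (ω.seq s a)).toAddMonoidHom.comp (coef s a))).compr₂
        (DirectSum.of (fun m : ω.carrier => R ⧸ (m : MaximalSpectrum R).asIdeal) (ω.seq s a))

theorem pairing_apply (hreal : ω.IsReal) (N : ℕ)
    (v' : FirstKind ω hfin m₀ hm₀ (ω.jIndex m₀ s) w.sharp)
    (v : FirstKind ω hfin m₀ hm₀ (ω.jIndex m₀ s) w) :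
    pairing hfin hm₀ s w hreal N v' v = ∑ a ∈ Finset.range N,
      DirectSum.of (fun m : ω.carrier => R ⧸ (m : MaximalSpectrum R).asIdeal) (ω.seq s a)
        (Ideal.Quotient.mk _ (scal s a) * coef s a v' * hreal.starQuot _ (coef s a v)) := by
  rw [pairing, AddMonoidHom.finsetSum_apply, AddMonoidHom.finsetSum_apply]
  rfl

section

variable (hreal : ω.IsReal) {N : ℕ}

theorem length_sharp : w.sharp.length = w.length := List.length_map _

theorem pairing_el_left {a : ℕ} (ha : a < N) (hN : ∀ a, ω.cnt s a ≤ w.length ↔ a < N)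
    (x : R ⧸ (ω.seq s a : MaximalSpectrum R).asIdeal)
    (v : FirstKind ω hfin m₀ hm₀ (ω.jIndex m₀ s) w) :
    pairing hfin hm₀ s w hreal N (el hfin hm₀ s w.sharp a x) v =
      DirectSum.of (fun m : ω.carrier => R ⧸ (m : MaximalSpectrum R).asIdeal) (ω.seq s a)
        (Ideal.Quotient.mk _ (scal s a) * x * hreal.starQuot _ (coef s a v)) := by
  rw [pairing_apply, Finset.sum_eq_single a, coef_el_self hfin hm₀]
  · rw [length_sharp]
    exact (hN a).2 ha
  · intro b _ hb
    rw [coef_el_of_ne hfin hm₀ hb.symm, mul_zero, zero_mul, map_zero]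
  · exact fun h => (h (Finset.mem_range.2 ha)).elim

theorem pairing_el_right {a : ℕ} (ha : a < N) (hN : ∀ a, ω.cnt s a ≤ w.length ↔ a < N)
    (x : R ⧸ (ω.seq s a : MaximalSpectrum R).asIdeal)
    (v : FirstKind ω hfin m₀ hm₀ (ω.jIndex m₀ s) w.sharp) :
    pairing hfin hm₀ s w hreal N v (el hfin hm₀ s w a x) =
      DirectSum.of (fun m : ω.carrier => R ⧸ (m : MaximalSpectrum R).asIdeal) (ω.seq s a)
        (Ideal.Quotient.mk _ (scal s a) * coef s a v * hreal.starQuot _ x) := by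
  rw [pairing_apply, Finset.sum_eq_single a, coef_el_self hfin hm₀ ((hN a).2 ha)]
  · intro b _ hb
    rw [coef_el_of_ne hfin hm₀ hb.symm, map_zero, mul_zero, map_zero]
  · exact fun h => (h (Finset.mem_range.2 ha)).elim

theorem pairing_el_of_ne {a b : ℕ} (h : a ≠ b)
    (x : R ⧸ (ω.seq s a : MaximalSpectrum R).asIdeal)
    (y : R ⧸ (ω.seq s b : MaximalSpectrum R).asIdeal) :
    pairing hfin hm₀ s w hreal N (el hfin hm₀ s w.sharp a x) (el hfin hm₀ s w b y) = 0 := by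
  rw [pairing_apply]
  refine Finset.sum_eq_zero fun c _ => ?_
  by_cases hc : a = c
  · subst hc
    rw [coef_el_of_ne hfin hm₀ h.symm y, map_zero, mul_zero, map_zero]
  · rw [coef_el_of_ne hfin hm₀ hc, mul_zero, zero_mul, map_zero]

theorem pairing_el_self {a : ℕ} (ha : a < N) (hN : ∀ a, ω.cnt s a ≤ w.length ↔ a < N)
    (q r : R) :
    pairing hfin hm₀ s w hreal N (el hfin hm₀ s w.sharp a (Ideal.Quotient.mk _ q))
        (el hfin hm₀ s w a (Ideal.Quotient.mk _ r)) =
      DirectSum.of (fun m : ω.carrier => R ⧸ (m : MaximalSpectrum R).asIdeal) (ω.seq s a)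
        (Ideal.Quotient.mk _ (scal s a * q * star r)) := by
  rw [pairing_el_left hreal ha hN, coef_el_self hfin hm₀ ((hN a).2 ha), IsReal.starQuot_mk,
    map_mul (Ideal.Quotient.mk _), map_mul (Ideal.Quotient.mk _)]

theorem pairing_smul_left (hs : ω.IsBreak (ω.prev s)) (r : R)
    (v' : FirstKind ω hfin m₀ hm₀ (ω.jIndex m₀ s) w.sharp)
    (v : FirstKind ω hfin m₀ hm₀ (ω.jIndex m₀ s) w) :
    pairing hfin hm₀ s w hreal N (D.ofR r • v') v = r • pairing hfin hm₀ s w hreal N v' v := by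
  rw [pairing_apply, pairing_apply, Finset.smul_sum]
  refine Finset.sum_congr rfl fun a _ => ?_
  rw [coef_smul hs, smul_of_apply]
  congr 1
  ring

theorem pairing_smul_right (hs : ω.IsBreak (ω.prev s)) (r : R)
    (v' : FirstKind ω hfin m₀ hm₀ (ω.jIndex m₀ s) w.sharp)
    (v : FirstKind ω hfin m₀ hm₀ (ω.jIndex m₀ s) w) :
    pairing hfin hm₀ s w hreal N v' (D.ofR r • v) =
      star r • pairing hfin hm₀ s w hreal N v' v := by
  rw [pairing_apply, pairing_apply, Finset.smul_sum]
  refine Finset.sum_congr rfl fun a _ => ?_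
  rw [coef_smul hs, smul_of_apply, map_mul (hreal.starQuot _), IsReal.starQuot_mk]
  congr 1
  ring

theorem sigma_of_seq (a : ℕ) (r : R) :
    ω.sigma (DirectSum.of (fun m : ω.carrier => R ⧸ (m : MaximalSpectrum R).asIdeal) (ω.seq s a)
        (Ideal.Quotient.mk _ r)) =
      DirectSum.of (fun m : ω.carrier => R ⧸ (m : MaximalSpectrum R).asIdeal) (ω.seq s (a + 1))
        (Ideal.Quotient.mk _ (D.σ r)) :=
  ω.sigma_of _ _

theorem pairing_X_smul (hs : ω.IsBreak (ω.prev s)) (hN : ∀ a, ω.cnt s a ≤ w.length ↔ a < N)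
    (v' : FirstKind ω hfin m₀ hm₀ (ω.jIndex m₀ s) w.sharp)
    (v : FirstKind ω hfin m₀ hm₀ (ω.jIndex m₀ s) w) :
    pairing hfin hm₀ s w hreal N (D.X • v') v =
      ω.sigma (pairing hfin hm₀ s w hreal N v' (D.Y • v)) := by
  have key : (pairing hfin hm₀ s w hreal N).comp (act _ D.X) =
      ((pairing hfin hm₀ s w hreal N).compl₂ (act _ D.Y)).compr₂ ω.sigma.toAddMonoidHom := by
    refine el_hom_ext₂ hs fun a b ha hb q r => ?_
    show pairing hfin hm₀ s w hreal N (D.X • el hfin hm₀ s w.sharp a _) (el hfin hm₀ s w b _) =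
      ω.sigma (pairing hfin hm₀ s w hreal N (el hfin hm₀ s w.sharp a _)
        (D.Y • el hfin hm₀ s w b _))
    rw [length_sharp, hN] at ha
    rw [hN] at hb
    rw [X_smul_el]
    rcases b with _ | b
    · rw [Y_smul_el_zero hs, map_zero, map_zero]
      split_ifs
      · exact pairing_el_of_ne hreal a.succ_ne_zero _ _
      · rw [map_zero, AddMonoidHom.zero_apply]
    rw [Y_smul_el_succ, hasX_sharp]
    by_cases h : a = b
    · subst h
      split_ifs
      · rw [pairing_el_self hreal hb hN, pairing_el_self hreal ha hN, sigma_of_seq]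
        congr 1
        -- Both sides are multiples of `σ(q) r*`; the factors `scal s (a + 1) * σ(tau s a)` and
        -- `σ(scal s a)` agree modulo the ideal by the recursion.
        rw [map_mul D.σ, map_mul D.σ, map_mul D.σ, D.σ_star, RingEquiv.apply_symm_apply,
          map_mul (Ideal.Quotient.mk _), map_mul (Ideal.Quotient.mk _),
          map_mul (Ideal.Quotient.mk _), map_mul (Ideal.Quotient.mk _),
          map_mul (Ideal.Quotient.mk _), ← mk_scal_succ_mul]
        ring
      · rw [map_zero, map_zero, AddMonoidHom.zero_apply, map_zero]
    · trans 0
      · split_ifs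
        · exact pairing_el_of_ne hreal (fun h' => h (Nat.succ_injective h')) _ _
        · rw [map_zero, AddMonoidHom.zero_apply]
      · split_ifs
        · rw [pairing_el_of_ne hreal h, map_zero]
        · rw [map_zero, map_zero]
  exact DFunLike.congr_fun (DFunLike.congr_fun key v') v

theorem pairing_Y_smul (hs : ω.IsBreak (ω.prev s)) (hN : ∀ a, ω.cnt s a ≤ w.length ↔ a < N)
    (v' : FirstKind ω hfin m₀ hm₀ (ω.jIndex m₀ s) w.sharp)
    (v : FirstKind ω hfin m₀ hm₀ (ω.jIndex m₀ s) w) :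
    pairing hfin hm₀ s w hreal N (D.Y • v') v =
      ω.sigma.symm (pairing hfin hm₀ s w hreal N v' (D.X • v)) := by
  rw [AddEquiv.eq_symm_apply]
  have key : ((pairing hfin hm₀ s w hreal N).comp (act _ D.Y)).compr₂ ω.sigma.toAddMonoidHom =
      (pairing hfin hm₀ s w hreal N).compl₂ (act _ D.X) := by
    refine el_hom_ext₂ hs fun a b ha hb q r => ?_
    show ω.sigma (pairing hfin hm₀ s w hreal N (D.Y • el hfin hm₀ s w.sharp a _)
        (el hfin hm₀ s w b _)) =
      pairing hfin hm₀ s w hreal N (el hfin hm₀ s w.sharp a _) (D.X • el hfin hm₀ s w b _)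
    rw [length_sharp, hN] at ha
    rw [hN] at hb
    rw [X_smul_el]
    rcases a with _ | a
    · rw [Y_smul_el_zero hs, map_zero, AddMonoidHom.zero_apply, map_zero]
      split_ifs
      · exact (pairing_el_of_ne hreal b.succ_ne_zero.symm _ _).symm
      · rw [map_zero]
    rw [Y_smul_el_succ, hasY_sharp]
    by_cases h : a = b
    · subst h
      split_ifs
      · rw [pairing_el_self hreal hb hN, pairing_el_self hreal ha hN, sigma_of_seq]
        congr 1
        -- Here `tau` enters through the second, conjugate-linear argument, so its selfadjointness
        -- is needed before the same recursion applies.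
        rw [map_mul D.σ, map_mul D.σ, map_mul D.σ, star_mul, ← D.σ_star, ← D.σ_star, star_tau,
          RingEquiv.apply_symm_apply, map_mul (Ideal.Quotient.mk _),
          map_mul (Ideal.Quotient.mk _), map_mul (Ideal.Quotient.mk _),
          map_mul (Ideal.Quotient.mk _), map_mul (Ideal.Quotient.mk _), ← mk_scal_succ_mul]
        ring
      · rw [map_zero, map_zero, AddMonoidHom.zero_apply, map_zero]
    · trans 0
      · split_ifs
        · rw [pairing_el_of_ne hreal h, map_zero]
        · rw [map_zero, AddMonoidHom.zero_apply, map_zero]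
      · split_ifs
        · exact (pairing_el_of_ne hreal (fun h' => h (Nat.succ_injective h')) _ _).symm
        · rw [map_zero]
  exact DFunLike.congr_fun (DFunLike.congr_fun key v') v

variable (hfin hm₀) in
/-- The `A`-linear map `V(ω, j, w^♯) → V(ω, j, w)^♯` given by the pairing. -/
def toFinDual (hs : ω.IsBreak (ω.prev s)) (hN : ∀ a, ω.cnt s a ≤ w.length ↔ a < N) :
    FirstKind ω hfin m₀ hm₀ (ω.jIndex m₀ s) w.sharp →ₗ[D.Alg]
      FinDual (FirstKind ω hfin m₀ hm₀ (ω.jIndex m₀ s) w) ω :=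
  linearMapOfGenerators
    { toFun := fun v' => ⟨pairing hfin hm₀ s w hreal N v',
        fun r v => pairing_smul_right hreal hs r v' v,
        -- The finiteness condition in the finitistic dual is automatic, because the orbit is
        -- finite.
        have := hfin.to_subtype
        Set.toFinite _⟩
      map_zero' := Subtype.ext (map_zero _)
      map_add' := fun _ _ => Subtype.ext (map_add _ _ _) }
    (fun r v' => FinDual.ext fun v => by
      rw [FinDual.ofR_smul_apply]
      exact pairing_smul_left hreal hs r v' v)
    (fun v' => FinDual.ext fun v => by
      rw [FinDual.X_smul_apply]
      exact pairing_X_smul hreal hs hN v' v)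
    (fun v' => FinDual.ext fun v => by
      rw [FinDual.Y_smul_apply]
      exact pairing_Y_smul hreal hs hN v' v)

theorem toHom_toFinDual (hs : ω.IsBreak (ω.prev s)) (hN : ∀ a, ω.cnt s a ≤ w.length ↔ a < N)
    (v' : FirstKind ω hfin m₀ hm₀ (ω.jIndex m₀ s) w.sharp)
    (v : FirstKind ω hfin m₀ hm₀ (ω.jIndex m₀ s) w) :
    (toFinDual hfin hm₀ hreal hs hN v').toHom v = pairing hfin hm₀ s w hreal N v' v := rfl

theorem of_seq_ne_zero {a : ℕ} {x : R ⧸ (ω.seq s a : MaximalSpectrum R).asIdeal} (hx : x ≠ 0) :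
    DirectSum.of (fun m : ω.carrier => R ⧸ (m : MaximalSpectrum R).asIdeal) (ω.seq s a) x ≠ 0 :=
  fun h => hx (DirectSum.of_injective
    (β := fun m : ω.carrier => R ⧸ (m : MaximalSpectrum R).asIdeal) _ (h.trans (map_zero _).symm))

/-- Pairing with the basis vector at a position where the coefficient is nonzero isolates that
coefficient, up to the unit `scal`. -/
theorem exists_pairing_ne_zero_left (hs : ω.IsBreak (ω.prev s))
    (hN : ∀ a, ω.cnt s a ≤ w.length ↔ a < N)
    {v' : FirstKind ω hfin m₀ hm₀ (ω.jIndex m₀ s) w.sharp} (hv' : v' ≠ 0) :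
    ∃ v, pairing hfin hm₀ s w hreal N v' v ≠ 0 := by
  obtain ⟨a, ha, h⟩ := exists_coef_ne_zero hs hv'
  rw [length_sharp, hN] at ha
  refine ⟨el hfin hm₀ s w a 1, ?_⟩
  rw [pairing_el_right hreal ha hN, map_one, mul_one]
  exact of_seq_ne_zero (mul_quotient_ne_zero (mk_scal_ne_zero s a) h)

theorem exists_pairing_ne_zero_right (hs : ω.IsBreak (ω.prev s))
    (hN : ∀ a, ω.cnt s a ≤ w.length ↔ a < N)
    {v : FirstKind ω hfin m₀ hm₀ (ω.jIndex m₀ s) w} (hv : v ≠ 0) :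
    ∃ v', pairing hfin hm₀ s w hreal N v' v ≠ 0 := by
  obtain ⟨a, ha, h⟩ := exists_coef_ne_zero hs hv
  rw [hN] at ha
  refine ⟨el hfin hm₀ s w.sharp a 1, ?_⟩
  rw [pairing_el_left hreal ha hN, mul_one]
  exact of_seq_ne_zero (mul_quotient_ne_zero (mk_scal_ne_zero s a) (hreal.starQuot_ne_zero h))

theorem toFinDual_injective (hs : ω.IsBreak (ω.prev s))
    (hN : ∀ a, ω.cnt s a ≤ w.length ↔ a < N) :
    Function.Injective (toFinDual hfin hm₀ hreal hs hN) := by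
  refine (injective_iff_map_eq_zero _).2 fun v' h => ?_
  by_contra hv'
  obtain ⟨v, hv⟩ := exists_pairing_ne_zero_left hreal hs hN hv'
  exact hv (by rw [← toHom_toFinDual hreal hs hN, h]; rfl)

/-- The basis vector has weight `𝔪`, so its image is killed by `𝔪* = 𝔪` and lies in the single
component `R ⧸ 𝔪` of `R_ω`. There `scal` is invertible and can be divided out, which yields the
coefficient of the preimage in `toFinDual_surjective`. -/
theorem exists_toHom_el_eq (hreal : ω.IsReal)
    (φ : FinDual (FirstKind ω hfin m₀ hm₀ (ω.jIndex m₀ s) w) ω) (a : ℕ) :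
    ∃ x, φ.toHom (el hfin hm₀ s w a 1) = DirectSum.of
      (fun m : ω.carrier => R ⧸ (m : MaximalSpectrum R).asIdeal) (ω.seq s a)
      (Ideal.Quotient.mk _ (scal s a) * x) := by
  have hr : ∀ r ∈ (ω.seq s a : MaximalSpectrum R).asIdeal,
      r • φ.toHom (el hfin hm₀ s w a 1) = 0 := by
    intro r hr
    rw [← star_star r, ← FinDual.map_ofR_smul, ← map_one (Ideal.Quotient.mk _), smul_el, mul_one,
      Ideal.Quotient.eq_zero_iff_mem.2 ((hreal _ (ω.seq s a).2 r).2 hr), map_zero, map_zero]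
  obtain ⟨c, hc⟩ := exists_mk_mul_eq_one (mk_scal_ne_zero s a)
  refine ⟨Ideal.Quotient.mk _ c * φ.toHom (el hfin hm₀ s w a 1) (ω.seq s a), ?_⟩
  rw [← mul_assoc, mul_comm (Ideal.Quotient.mk _ (scal s a)), hc, one_mul]
  exact eq_of_apply_of_smul_eq_zero hr

theorem toFinDual_surjective (hs : ω.IsBreak (ω.prev s))
    (hN : ∀ a, ω.cnt s a ≤ w.length ↔ a < N) :
    Function.Surjective (toFinDual hfin hm₀ hreal hs hN) := by
  intro φ
  choose x hx using exists_toHom_el_eq hreal φ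
  refine ⟨∑ a ∈ Finset.range N, el hfin hm₀ s w.sharp a (x a), FinDual.ext fun v => ?_⟩
  rw [toHom_toFinDual]
  have key : pairing hfin hm₀ s w hreal N
      (∑ a ∈ Finset.range N, el hfin hm₀ s w.sharp a (x a)) = φ.toHom := by
    refine el_hom_ext hs fun b hb r => ?_
    rw [hN] at hb
    have hr : φ.toHom (el hfin hm₀ s w b (Ideal.Quotient.mk _ r)) =
        star r • φ.toHom (el hfin hm₀ s w b 1) := by
      rw [← FinDual.map_ofR_smul, ← map_one (Ideal.Quotient.mk _), smul_el, mul_one]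
    rw [hr, hx, smul_of_apply, map_sum, AddMonoidHom.finsetSum_apply, Finset.sum_eq_single b]
    · rw [pairing_el_right hreal hb hN, coef_el_self hfin hm₀ (by rwa [length_sharp, hN]),
        IsReal.starQuot_mk, mul_comm]
    · exact fun a _ hab => pairing_el_of_ne hreal hab _ _
    · exact fun h => (h (Finset.mem_range.2 hb)).elim
  exact DFunLike.congr_fun key v

end

end FirstKind

/-! ### Admissible forms as `A`-linear maps to the finitistic dual -/

open Orbit

theorem zpow_sigma_add {ω : D.Orbit} (n : ℤ) (x y : ω.Rω) :
    ((ω.sigma.toEquiv : Equiv.Perm ω.Rω) ^ n) (x + y) =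
      ((ω.sigma.toEquiv : Equiv.Perm ω.Rω) ^ n) x +
        ((ω.sigma.toEquiv : Equiv.Perm ω.Rω) ^ n) y := by
  induction n generalizing x y with
  | zero => rfl
  | succ n ih =>
    rw [zpow_add_one]
    exact (congrArg _ (map_add ω.sigma x y)).trans (ih _ _)
  | pred n ih =>
    rw [zpow_sub_one]
    exact (congrArg _ (map_add ω.sigma.symm x y)).trans (ih _ _)

/-- The action of the homogeneous elements of `A` on the finitistic dual. -/
theorem FinDual.smul_apply_of_isHomogeneous {V : Type*} [AddCommGroup V] [Module D.Alg V]
    {ω : D.Orbit} {n : ℤ} {a : D.Alg} (ha : D.IsHomogeneous n a) :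
    ∀ (φ : FinDual V ω) (v : V), (a • φ).toHom v =
      ((ω.sigma.toEquiv : Equiv.Perm ω.Rω) ^ n) (φ.toHom (star a • v)) := by
  induction ha with
  | ofR r =>
    intro φ v
    rw [FinDual.ofR_smul_apply, D.star_ofR, FinDual.map_ofR_smul, star_star]
    rfl
  | X =>
    intro φ v
    rw [FinDual.X_smul_apply, D.star_X, zpow_one]
    rfl
  | Y =>
    intro φ v
    rw [FinDual.Y_smul_apply, D.star_Y, zpow_neg_one]
    rfl
  | mul _ _ iha ihb =>
    intro φ v
    rw [mul_smul, iha, ihb, star_mul, mul_smul, zpow_add, Equiv.Perm.mul_apply]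
  | add _ _ iha ihb =>
    intro φ v
    rw [star_add, add_smul, add_smul, map_add, zpow_sigma_add, ← iha, ← ihb]
    rfl

/-- The map from `V` to its finitistic dual given by an admissible form. -/
def IsAdmissibleForm.toFinDual {V : Type*} [AddCommGroup V] [Module D.Alg V] {ω : D.Orbit}
    {F : V → V → ω.Rω} (hF : IsAdmissibleForm V ω F) (hfin : ω.carrier.Finite) :
    V →ₗ[D.Alg] FinDual V ω :=
  linearMapOfGenerators
    (AddMonoidHom.mk' (fun v => ⟨AddMonoidHom.mk' (F v) (hF.add_right v), fun r v' => by
        show F v (D.ofR r • v') = star r • F v v'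
        -- Conjugate-linearity in the second argument is linearity in the first combined with the
        -- degree `0` case of homogeneity, applied to `star r`.
        rw [← hF.smul_left, hF.homogeneous 0 _ (.ofR _), D.star_ofR, star_star]
        rfl,
        have := hfin.to_subtype
        Set.toFinite _⟩)
      fun v₁ v₂ => FinDual.ext fun v => hF.add_left v₁ v₂ v)
    (fun r v => FinDual.ext fun v' => by
      rw [FinDual.ofR_smul_apply]
      exact hF.smul_left r v v')
    (fun v => FinDual.ext fun v' => by
      rw [FinDual.X_smul_apply, ← D.star_X]
      exact hF.homogeneous 1 _ .X v v')
    (fun v => FinDual.ext fun v' => by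
      rw [FinDual.Y_smul_apply, ← D.star_Y]
      exact hF.homogeneous (-1) _ .Y v v')

theorem IsAdmissibleForm.toHom_toFinDual {V : Type*} [AddCommGroup V] [Module D.Alg V]
    {ω : D.Orbit} {F : V → V → ω.Rω} (hF : IsAdmissibleForm V ω F) (hfin : ω.carrier.Finite)
    (v v' : V) : (hF.toFinDual hfin v).toHom v' = F v v' := rfl

namespace FirstKind

variable {ω : D.Orbit} {hfin : ω.carrier.Finite} {m₀ : MaximalSpectrum R} {hm₀ : m₀ ∈ ω.breaks}
  {s : ω.carrier} {w : Word}

/-! ### Weights -/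

theorem el_mem_weightSpace (a : ℕ) (x : R ⧸ (ω.seq s a : MaximalSpectrum R).asIdeal) :
    el hfin hm₀ s w a x ∈
      D.weightSpace (FirstKind ω hfin m₀ hm₀ (ω.jIndex m₀ s) w) (ω.seq s a) := by
  intro r hr
  obtain ⟨q, rfl⟩ := Ideal.Quotient.mk_surjective x
  rw [smul_el, Ideal.Quotient.eq_zero_iff_mem.2 (Ideal.mul_mem_right _ _ hr), map_zero]

/-- A weight vector involves only positions lying over its own weight: a nonzero coefficient at `a`
is killed by `m`. -/
theorem eq_of_coef_ne_zero (hs : ω.IsBreak (ω.prev s)) {m : MaximalSpectrum R}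
    {v : FirstKind ω hfin m₀ hm₀ (ω.jIndex m₀ s) w} (hv : v ∈ D.weightSpace _ m) {a : ℕ}
    (h : coef s a v ≠ 0) : m = ω.seq s a :=
  eq_of_quotient_ne_zero h fun r hr => by rw [← coef_smul hs, hv r hr, map_zero]

theorem support_subset (hs : ω.IsBreak (ω.prev s)) :
    D.support (FirstKind ω hfin m₀ hm₀ (ω.jIndex m₀ s) w) ⊆ ω.carrier := by
  intro m hm
  obtain ⟨v, hv, hv0⟩ := (AddSubgroup.bot_or_exists_ne_zero _).resolve_left hm
  obtain ⟨a, -, ha⟩ := exists_coef_ne_zero hs hv0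
  rw [eq_of_coef_ne_zero hs hv ha]
  exact (ω.seq s a).2

theorem isWeightModule (hs : ω.IsBreak (ω.prev s)) :
    D.IsWeightModule (FirstKind ω hfin m₀ hm₀ (ω.jIndex m₀ s) w) := by
  constructor
  · refine (injective_iff_map_eq_zero _).2 fun f hf => ?_
    have hcoef : ∀ a m, m ≠ (ω.seq s a : MaximalSpectrum R) →
        coef s a (f m : FirstKind ω hfin m₀ hm₀ (ω.jIndex m₀ s) w) = 0 := by
      intro a m hm
      by_contra h
      exact hm (eq_of_coef_ne_zero hs (f m).2 h)
    refine DFinsupp.ext fun m => Subtype.ext (ext_coef hs fun a _ => ?_)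
    -- In the vanishing sum of weight vectors, the coefficient at `a` sees only the summand of
    -- weight `ω.seq s a`, so that summand has coefficient zero there.
    by_cases hm : m = ω.seq s a
    · have h := congrArg (coef s a) hf
      rw [DirectSum.coeAddMonoidHom_eq_dfinsuppSum, DFinsupp.sum, map_sum,
        Finset.sum_eq_single m, map_zero] at h
      · exact h.trans (map_zero _).symm
      · exact fun m' _ hm' => hcoef a m' (hm ▸ hm')
      · intro hm'
        rw [DFinsupp.notMem_support_iff.1 hm']
        exact map_zero _
    · exact (hcoef a m hm).trans (map_zero _).symm
  · intro v
    obtain ⟨L, -, -, hL⟩ := exists_bound hfin hm₀ s w.length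
    refine ⟨∑ a ∈ Finset.range (L + 1), DirectSum.of (fun m => D.weightSpace
      (FirstKind ω hfin m₀ hm₀ (ω.jIndex m₀ s) w) m) (ω.seq s a)
        ⟨el hfin hm₀ s w a (coef s a v), el_mem_weightSpace a _⟩, ?_⟩
    rw [map_sum]
    conv_rhs => rw [eq_sum_el hs hL v]
    exact Finset.sum_congr rfl fun a _ => DirectSum.coeAddMonoidHom_of _ _ _

/-! ### Homomorphisms between modules of the first kind -/

section homs

variable {w' : Word} (f : FirstKind ω hfin m₀ hm₀ (ω.jIndex m₀ s) w →ₗ[D.Alg]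
  FirstKind ω hfin m₀ hm₀ (ω.jIndex m₀ s) w')

/-- The matrix entry of a linear map at the positions `a` and `b` is not zero. -/
def EntryNeZero (a b : ℕ) : Prop := ∃ x, coef s b (f (el hfin hm₀ s w a x)) ≠ 0

variable {f}

/-- In the target `X` carries the coefficient at `b` to `b + 1` up to a unit, so `f` of `X` times
the source vector is nonzero, and `X` cannot kill the source vector. Thus the letter `x` passes from
target to source. -/
theorem EntryNeZero.of_hasX (hs : ω.IsBreak (ω.prev s)) {a b : ℕ} (h : EntryNeZero f a b)
    (hx : HasX s w' b) : HasX s w a ∧ EntryNeZero f (a + 1) (b + 1) := by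
  obtain ⟨x, h⟩ := h
  obtain ⟨r, rfl⟩ := Ideal.Quotient.mk_surjective x
  have h' : coef s (b + 1) (f (D.X • el hfin hm₀ s w a (Ideal.Quotient.mk _ r))) ≠ 0 := by
    rw [map_smul, coef_succ_X_smul hs, if_pos hx]
    exact fun h0 => mul_quotient_ne_zero (mk_ne_zero (tau_notMem b)) h (shift_eq_zero.1 h0)
  rw [X_smul_el] at h'
  split_ifs at h' with hx'
  · exact ⟨hx', _, h'⟩
  · exact (h' (by rw [map_zero, map_zero])).elim

/-- The source vector at `a` is `Y` times one at `a + 1`, so the coefficient of its image at `b`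
must have come from `b + 1` under `Y`. Thus `y` passes from source to target, opposite to `x`. -/
theorem EntryNeZero.of_hasY (hs : ω.IsBreak (ω.prev s)) {a b : ℕ} (h : EntryNeZero f a b)
    (hy : HasY s w a) : HasY s w' b ∧ EntryNeZero f (a + 1) (b + 1) := by
  obtain ⟨x, h⟩ := h
  obtain ⟨r, rfl⟩ := Ideal.Quotient.mk_surjective x
  have he := Y_smul_el_succ (hfin := hfin) (hm₀ := hm₀) (s := s) (w := w) a (D.σ r)
  rw [if_pos hy, RingEquiv.symm_apply_apply] at he
  have h' := mt shift_eq_zero.1 h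
  rw [← he, map_smul, shift_coef_Y_smul hs] at h'
  split_ifs at h' with hy'
  · exact ⟨hy', _, h'⟩
  · exact (h' rfl).elim

theorem exists_entryNeZero (hs : ω.IsBreak (ω.prev s))
    {g : FirstKind ω hfin m₀ hm₀ (ω.jIndex m₀ s) w' →ₗ[D.Alg]
      FirstKind ω hfin m₀ hm₀ (ω.jIndex m₀ s) w} {a : ℕ} (h : EntryNeZero (g ∘ₗ f) a a) :
    ∃ b, EntryNeZero f a b ∧ EntryNeZero g b a := by
  obtain ⟨x, h⟩ := h
  obtain ⟨L, -, -, hL⟩ := exists_bound hfin hm₀ s w'.length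
  rw [LinearMap.comp_apply, eq_sum_el hs hL (f _), map_sum, map_sum] at h
  obtain ⟨b, -, hb⟩ := Finset.exists_ne_zero_of_sum_ne_zero h
  refine ⟨b, ⟨x, fun h0 => hb ?_⟩, _, hb⟩
  rw [h0, map_zero, map_zero, map_zero]

/-- As `x` and `y` pass in opposite directions, maps both ways are needed: the map for which the
letter at `a` passes from `w` to `w'` gives the letter at `b`, and then the other map advances too.
-/
theorem EntryNeZero.succ (hs : ω.IsBreak (ω.prev s))
    {g : FirstKind ω hfin m₀ hm₀ (ω.jIndex m₀ s) w' →ₗ[D.Alg]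
      FirstKind ω hfin m₀ hm₀ (ω.jIndex m₀ s) w} {a b : ℕ} (hf : EntryNeZero f a b)
    (hg : EntryNeZero g b a) (ha : ω.cnt s (a + 1) ≤ w.length) :
    EntryNeZero f (a + 1) (b + 1) ∧ EntryNeZero g (b + 1) (a + 1) := by
  rcases hasX_or_hasY ha with hx | hy
  · obtain ⟨hx', hg'⟩ := hg.of_hasX hs hx
    exact ⟨(hf.of_hasX hs hx').2, hg'⟩
  · obtain ⟨hy', hf'⟩ := hf.of_hasY hs hy
    exact ⟨hf', (hg.of_hasY hs hy').2⟩

/-- Nonzero entries of `e` and its inverse run along a diagonal over the whole string. Equal lengths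
put it on the main diagonal, so both words have the same first letter, whereas `w.sharp` has the
exchanged one. -/
theorem eq_nil_of_equiv_sharp (hs : ω.IsBreak (ω.prev s))
    (e : FirstKind ω hfin m₀ hm₀ (ω.jIndex m₀ s) w ≃ₗ[D.Alg]
      FirstKind ω hfin m₀ hm₀ (ω.jIndex m₀ s) w.sharp) : w = [] := by
  by_contra hw
  have h0 : ω.cnt s 0 ≤ w.length := (cnt_zero s).trans_le (Nat.zero_le _)
  have hcomp : EntryNeZero (e.symm.toLinearMap ∘ₗ e.toLinearMap) 0 0 := by
    refine ⟨1, ?_⟩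
    rw [LinearMap.comp_apply, LinearEquiv.coe_coe, LinearEquiv.coe_coe, e.symm_apply_apply,
      coef_el_self hfin hm₀ h0]
    exact one_quotient_ne_zero _
  obtain ⟨b, hf, hg⟩ := exists_entryNeZero hs hcomp
  have hchain : ∀ a, ω.cnt s a ≤ w.length →
      EntryNeZero e.toLinearMap a (b + a) ∧ EntryNeZero e.symm.toLinearMap (b + a) a := by
    intro a
    induction a with
    | zero => exact fun _ => ⟨hf, hg⟩
    | succ a ih =>
      intro ha
      obtain ⟨h1, h2⟩ := ih ((cnt_mono s a.le_succ).trans ha)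
      exact h1.succ hs h2 ha
  obtain ⟨L, -, hL, hL'⟩ := exists_bound hfin hm₀ s w.length
  -- The diagonal starting at `(0, b)` reaches `(L, b + L)`, but there are no coefficients beyond
  -- position `L`.
  have hb : b = 0 := by
    obtain ⟨x, hx⟩ := (hchain L hL.le).1
    have h : ω.cnt s (b + L) ≤ w.sharp.length := by
      by_contra h
      exact hx (coef_of_lt hfin hm₀ (not_le.1 h) _)
    rw [length_sharp, hL'] at h
    omega
  subst hb
  -- Position `k` is the first break, where the first letter is read.
  obtain ⟨k, hk, hk0, -⟩ := exists_bound hfin hm₀ s 0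
  obtain ⟨h1, h2⟩ := hchain k (hk0.trans_le (Nat.zero_le _))
  rw [zero_add] at h1 h2
  have hk1 : ω.cnt s (k + 1) ≤ w.length := by
    rw [cnt_succ_of_isBreak hk, hk0]
    exact List.length_pos_of_ne_nil hw
  have hxy : HasX s w k ∧ HasY s w k := by
    rcases hasX_or_hasY hk1 with hx | hy
    · exact ⟨hx, hasX_sharp.1 (h2.of_hasX hs hx).1⟩
    · exact ⟨hasY_sharp.1 (h1.of_hasY hs hy).1, hy⟩
  have := (hxy.1 hk).symm.trans (hxy.2 hk)
  simp at this

end homs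

/-! ### Surjectivity of injective maps -/

/-- The module is a finite sum of simple `R`-modules `R ⧸ 𝔪`, possibly over different fields; the
Artinian property replaces a dimension count. -/
instance isArtinian : IsArtinian R (FirstKind ω hfin m₀ hm₀ (ω.jIndex m₀ s) w) := by
  have := hfin.to_subtype
  have := Fintype.ofFinite (FirstKindIndex ω m₀ (ω.jIndex m₀ s) w)
  have : ∀ b : FirstKindIndex ω m₀ (ω.jIndex m₀ s) w,
      IsArtinian R (R ⧸ (b.1.1 : MaximalSpectrum R).asIdeal) := fun b =>
    have := (isSimpleModule_iff_isCoatom (R := R)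
      (m := (b.1.1 : MaximalSpectrum R).asIdeal)).2 (b.1.1 : MaximalSpectrum R).isMaximal.out
    inferInstance
  exact isArtinian_of_linearEquiv (DirectSum.linearEquivFunOnFintype R
    (FirstKindIndex ω m₀ (ω.jIndex m₀ s) w)
    (fun b => R ⧸ (b.1.1 : MaximalSpectrum R).asIdeal)).symm

variable (hfin hm₀ s w) in
/-- The additive map `V(ω, j, w^♯) → V(ω, j, w)` which matches the standard bases. -/
def ofSharp (N : ℕ) : FirstKind ω hfin m₀ hm₀ (ω.jIndex m₀ s) w.sharp →+
    FirstKind ω hfin m₀ hm₀ (ω.jIndex m₀ s) w :=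
  ∑ a ∈ Finset.range N, (el hfin hm₀ s w a).comp (coef s a)

theorem ofSharp_apply (N : ℕ) (v : FirstKind ω hfin m₀ hm₀ (ω.jIndex m₀ s) w.sharp) :
    ofSharp hfin hm₀ s w N v = ∑ a ∈ Finset.range N, el hfin hm₀ s w a (coef s a v) := by
  rw [ofSharp, AddMonoidHom.finsetSum_apply]
  rfl

theorem coef_ofSharp {N : ℕ} (hN : ∀ a, ω.cnt s a ≤ w.length ↔ a < N) {a : ℕ} (ha : a < N)
    (v : FirstKind ω hfin m₀ hm₀ (ω.jIndex m₀ s) w.sharp) :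
    coef s a (ofSharp hfin hm₀ s w N v) = coef s a v := by
  rw [ofSharp_apply, map_sum, Finset.sum_eq_single a, coef_el_self hfin hm₀ ((hN a).2 ha)]
  · exact fun b _ hb => coef_el_of_ne hfin hm₀ hb _
  · exact fun h => (h (Finset.mem_range.2 ha)).elim

theorem ofSharp_injective (hs : ω.IsBreak (ω.prev s)) {N : ℕ}
    (hN : ∀ a, ω.cnt s a ≤ w.length ↔ a < N) :
    Function.Injective (ofSharp hfin hm₀ s w N) := by
  intro v v' h
  refine ext_coef hs fun a ha => ?_
  rw [length_sharp, hN] at ha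
  rw [← coef_ofSharp hN ha, ← coef_ofSharp hN ha, h]

theorem ofSharp_smul (hs : ω.IsBreak (ω.prev s)) {N : ℕ}
    (hN : ∀ a, ω.cnt s a ≤ w.length ↔ a < N) (r : R)
    (v : FirstKind ω hfin m₀ hm₀ (ω.jIndex m₀ s) w.sharp) :
    ofSharp hfin hm₀ s w N (D.ofR r • v) = D.ofR r • ofSharp hfin hm₀ s w N v := by
  refine ext_coef hs fun a ha => ?_
  rw [hN] at ha
  rw [coef_ofSharp hN ha, coef_smul hs, coef_smul hs, coef_ofSharp hN ha]

/-- Followed by the `R`-linear injection `ofSharp`, the map becomes an injective endomorphism of an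
Artinian `R`-module, hence surjective. Injectivity of `ofSharp` then gives the claim for `f` itself.
-/
theorem surjective_of_injective (hs : ω.IsBreak (ω.prev s))
    (f : FirstKind ω hfin m₀ hm₀ (ω.jIndex m₀ s) w →ₗ[D.Alg]
      FirstKind ω hfin m₀ hm₀ (ω.jIndex m₀ s) w.sharp) (hf : Function.Injective f) :
    Function.Surjective f := by
  obtain ⟨L, -, -, hL⟩ := exists_bound hfin hm₀ s w.length
  let h : FirstKind ω hfin m₀ hm₀ (ω.jIndex m₀ s) w →ₗ[R]
      FirstKind ω hfin m₀ hm₀ (ω.jIndex m₀ s) w :=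
    { toFun := fun v => ofSharp hfin hm₀ s w (L + 1) (f v)
      map_add' := fun v v' => by rw [map_add, map_add]
      map_smul' := fun r v => by
        rw [← ofR_smul, map_smul, ofSharp_smul hs hL, ofR_smul]
        rfl }
  have hsurj := IsArtinian.surjective_of_injective_endomorphism h
    ((ofSharp_injective hs hL).comp hf)
  intro v
  obtain ⟨v', hv'⟩ := hsurj (ofSharp hfin hm₀ s w (L + 1) v)
  exact ⟨v', ofSharp_injective hs hL hv'⟩

/-! ### Duality and forms -/

variable (hfin hm₀ w) in
/-- The isomorphism of `V(ω, j, w^♯)` with the finitistic dual of `V(ω, j, w)`. -/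
theorem nonempty_equiv_finDual (hreal : ω.IsReal) (hs : ω.IsBreak (ω.prev s)) :
    Nonempty (FirstKind ω hfin m₀ hm₀ (ω.jIndex m₀ s) w.sharp ≃ₗ[D.Alg]
      FinDual (FirstKind ω hfin m₀ hm₀ (ω.jIndex m₀ s) w) ω) := by
  obtain ⟨L, -, -, hL⟩ := exists_bound hfin hm₀ s w.length
  exact ⟨LinearEquiv.ofBijective (toFinDual hfin hm₀ hreal hs hL)
    ⟨toFinDual_injective hreal hs hL, toFinDual_surjective hreal hs hL⟩⟩

theorem eq_nil_of_isPseudoUnitarizable (hreal : ω.IsReal) (hs : ω.IsBreak (ω.prev s))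
    (h : IsPseudoUnitarizable (FirstKind ω hfin m₀ hm₀ (ω.jIndex m₀ s) w) ω) : w = [] := by
  obtain ⟨-, -, F, hF, hnd⟩ := h
  obtain ⟨e⟩ := nonempty_equiv_finDual hfin hm₀ w hreal hs
  have hinj : Function.Injective (hF.toFinDual hfin) := by
    refine (injective_iff_map_eq_zero _).2 fun v hv => ?_
    by_contra hv0
    obtain ⟨-, v', -, hv'⟩ := hnd v hv0
    exact hv' (by rw [← hF.toHom_toFinDual hfin, hv]; rfl)
  have hinj' : Function.Injective (e.symm.toLinearMap ∘ₗ hF.toFinDual hfin) :=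
    e.symm.injective.comp hinj
  exact eq_nil_of_equiv_sharp hs
    (LinearEquiv.ofBijective _ ⟨hinj', surjective_of_injective hs _ hinj'⟩)

theorem isPseudoUnitarizable_nil (hreal : ω.IsReal) (hs : ω.IsBreak (ω.prev s)) :
    IsPseudoUnitarizable (FirstKind ω hfin m₀ hm₀ (ω.jIndex m₀ s) []) ω := by
  obtain ⟨L, -, -, hL⟩ := exists_bound hfin hm₀ s ([] : Word).length
  refine ⟨isWeightModule hs, support_subset hs,
    fun v v' => pairing hfin hm₀ s [] hreal (L + 1) v v', ⟨?_, ?_, ?_, ?_⟩, ?_⟩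
  · intro v₁ v₂ v
    exact DFunLike.congr_fun (map_add (pairing hfin hm₀ s [] hreal (L + 1)) v₁ v₂) v
  · intro v v₁ v₂
    exact map_add _ v₁ v₂
  · intro r v v'
    exact pairing_smul_left hreal hs r v v'
  · intro n a ha v v'
    -- The empty word is its own exchange by definition, so the pairing is a form on a single
    -- module, and its homogeneity is the `A`-linearity of `toFinDual`.
    have h := congrArg (fun φ => φ.toHom v') ((toFinDual hfin hm₀ hreal hs hL).map_smul a v)
    exact h.trans (FinDual.smul_apply_of_isHomogeneous ha _ v')
  · intro v hv
    obtain ⟨v₁, h₁⟩ := exists_pairing_ne_zero_right hreal hs hL hv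
    obtain ⟨v₂, h₂⟩ := exists_pairing_ne_zero_left (w := []) hreal hs hL (v' := v) hv
    exact ⟨v₁, v₂, h₁, h₂⟩

/-! ### Simplicity -/

theorem el_ne_zero {a : ℕ} (ha : ω.cnt s a ≤ w.length)
    {x : R ⧸ (ω.seq s a : MaximalSpectrum R).asIdeal} (hx : x ≠ 0) :
    el hfin hm₀ s w a x ≠ 0 := fun h => hx (by
  rw [← coef_el_self hfin hm₀ ha x, h, map_zero])

theorem el_mem_of_el_mem {S : Submodule D.Alg (FirstKind ω hfin m₀ hm₀ (ω.jIndex m₀ s) w)}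
    {a : ℕ} {x : R ⧸ (ω.seq s a : MaximalSpectrum R).asIdeal} (hx : x ≠ 0)
    (h : el hfin hm₀ s w a x ∈ S) (y : R ⧸ (ω.seq s a : MaximalSpectrum R).asIdeal) :
    el hfin hm₀ s w a y ∈ S := by
  obtain ⟨r, hr⟩ := exists_mk_mul_eq_one hx
  obtain ⟨p, rfl⟩ := Ideal.Quotient.mk_surjective x
  obtain ⟨q, rfl⟩ := Ideal.Quotient.mk_surjective y
  have h' := S.smul_mem (D.ofR (q * r)) h
  rwa [smul_el, mul_assoc, map_mul (Ideal.Quotient.mk _), map_mul (Ideal.Quotient.mk _), hr,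
    mul_one] at h'

theorem isSimpleModule_nil (hs : ω.IsBreak (ω.prev s)) :
    IsSimpleModule D.Alg (FirstKind ω hfin m₀ hm₀ (ω.jIndex m₀ s) []) := by
  obtain ⟨L, -, hcL, hL⟩ := exists_bound hfin hm₀ s ([] : Word).length
  -- For the empty word the string is a single segment whose only break is its last position `L`.
  have hbreak : ∀ a < L, ¬ ω.IsBreak (ω.seq s a) := by
    intro a ha hb
    have h := (hL (a + 1)).2 (by omega)
    rw [cnt_succ_of_isBreak hb] at h
    exact absurd h (by simp)
  have h0 : ω.cnt s 0 ≤ ([] : Word).length := (cnt_zero s).le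
  -- If `a` is the lowest position occurring in `v`, then applying `X` exactly `L - a` times pushes
  -- everything above it off the end and leaves a nonzero multiple of the last basis vector.
  have htop : ∀ (S : Submodule D.Alg (FirstKind ω hfin m₀ hm₀ (ω.jIndex m₀ s) [])) (d a : ℕ),
      a + d = L → ∀ v ∈ S, (∀ b < a, coef s b v = 0) → coef s a v ≠ 0 →
        ∃ x ≠ 0, el hfin hm₀ s [] L x ∈ S := by
    intro S d
    induction d with
    | zero =>
      intro a had v hv hb ha
      obtain rfl : a = L := had
      refine ⟨_, ha, ?_⟩
      convert hv using 1
      refine ext_coef hs fun b hb' => ?_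
      rw [hL] at hb'
      rcases (Nat.lt_succ_iff.1 hb').lt_or_eq with hlt | rfl
      · rw [coef_el_of_ne hfin hm₀ hlt.ne', hb b hlt]
      · rw [coef_el_self hfin hm₀ ((hL _).2 hb')]
    | succ d ih =>
      intro a had v hv hb ha
      refine ih (a + 1) (by omega) (D.X • v) (S.smul_mem _ hv) ?_ ?_
      · rintro (_ | b) hb'
        · exact coef_zero_X_smul hs v
        · rw [coef_succ_X_smul hs, hb b (by omega), mul_zero, map_zero, ite_self]
      · have hx : HasX s [] a := fun h => (hbreak a (by omega) h).elim
        rw [coef_succ_X_smul hs, if_pos hx]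
        exact fun h => mul_quotient_ne_zero (mk_ne_zero (tau_notMem a)) ha (shift_eq_zero.1 h)
  -- From the last basis vector, powers of `Y` descend to all the others.
  have hdown : ∀ (S : Submodule D.Alg (FirstKind ω hfin m₀ hm₀ (ω.jIndex m₀ s) [])) (d a : ℕ),
      a + d = L → (∃ x ≠ 0, el hfin hm₀ s [] L x ∈ S) → ∃ x ≠ 0, el hfin hm₀ s [] a x ∈ S := by
    intro S d
    induction d with
    | zero =>
      rintro a rfl h
      exact h
    | succ d ih =>
      intro a had h
      obtain ⟨x, hx, hS⟩ := ih (a + 1) (by omega) h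
      have hY := S.smul_mem D.Y (el_mem_of_el_mem hx hS (Ideal.Quotient.mk _ 1))
      have hy : HasY s [] a := fun h => (hbreak a (by omega) h).elim
      rw [Y_smul_el_succ, if_pos hy, map_one, map_one] at hY
      exact ⟨1, one_quotient_ne_zero _, hY⟩
  have hne : Nontrivial (FirstKind ω hfin m₀ hm₀ (ω.jIndex m₀ s) []) :=
    ⟨_, 0, el_ne_zero h0 (one_quotient_ne_zero _)⟩
  rw [isSimpleModule_iff]
  refine { exists_pair_ne := ⟨⊥, ⊤, bot_ne_top⟩, eq_bot_or_eq_top := fun S => ?_ }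
  refine or_iff_not_imp_left.2 fun hS => (Submodule.eq_top_iff').2 fun v => ?_
  obtain ⟨v₀, hv₀, hne₀⟩ := S.ne_bot_iff.1 hS
  have hex := exists_coef_ne_zero hs hne₀
  have hlt : Nat.find hex < L + 1 := (hL _).1 (Nat.find_spec hex).1
  have hmin : ∀ b < Nat.find hex, coef s b v₀ = 0 := by
    intro b hb
    by_contra h
    exact Nat.find_min hex hb ⟨(hL b).2 (hb.trans hlt), h⟩
  have hx := htop S (L - Nat.find hex) (Nat.find hex) (by omega) v₀ hv₀ hmin
    (Nat.find_spec hex).2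
  rw [eq_sum_el hs hL v]
  refine S.sum_mem fun a ha => ?_
  rw [Finset.mem_range] at ha
  obtain ⟨x, hx0, hxS⟩ := hdown S (L - a) a (by omega) hx
  exact el_mem_of_el_mem hx0 hxS _

/-- A set of positions which is closed under the arrows of the string leads to a submodule. -/
def coefSubmodule (hs : ω.IsBreak (ω.prev s)) (Q : ℕ → Prop)
    (hX : ∀ a, HasX s w a → Q (a + 1) → Q a) (hY : ∀ a, HasY s w a → Q a → Q (a + 1)) :
    Submodule D.Alg (FirstKind ω hfin m₀ hm₀ (ω.jIndex m₀ s) w) :=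
  submoduleOfGenerators
    { carrier := {v | ∀ a, Q a → coef s a v = 0}
      zero_mem' := fun a _ => map_zero _
      add_mem' := fun h h' a ha => by rw [map_add, h a ha, h' a ha, add_zero]
      neg_mem' := fun h a ha => by rw [map_neg, h a ha, neg_zero] }
    (fun r v hv a ha => by rw [coef_smul hs, hv a ha, mul_zero])
    (fun v hv a ha => by
      rcases a with _ | a
      · exact coef_zero_X_smul hs v
      · rw [coef_succ_X_smul hs]
        split_ifs with hx
        · rw [hv a (hX a hx ha), mul_zero, map_zero]
        · rfl)
    (fun v hv a ha => by
      rw [← shift_eq_zero, shift_coef_Y_smul hs]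
      split_ifs with hy
      · exact hv (a + 1) (hY a hy ha)
      · rfl)

theorem not_isSimpleModule_of_closed (hs : ω.IsBreak (ω.prev s)) (Q : ℕ → Prop)
    (hX : ∀ a, HasX s w a → Q (a + 1) → Q a) (hY : ∀ a, HasY s w a → Q a → Q (a + 1)) {a b : ℕ}
    (ha : ω.cnt s a ≤ w.length) (hQa : Q a) (hb : ω.cnt s b ≤ w.length) (hQb : ¬ Q b) :
    ¬ IsSimpleModule D.Alg (FirstKind ω hfin m₀ hm₀ (ω.jIndex m₀ s) w) := by
  intro hsimple
  rcases eq_bot_or_eq_top (coefSubmodule (hfin := hfin) (hm₀ := hm₀) hs Q hX hY) with h | h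
  · have hmem : el hfin hm₀ s w b 1 ∈ coefSubmodule (hfin := hfin) (hm₀ := hm₀) hs Q hX hY :=
      fun c hc => coef_el_of_ne hfin hm₀ (by rintro rfl; exact hQb hc) _
    rw [h, Submodule.mem_bot] at hmem
    exact el_ne_zero hb (one_quotient_ne_zero _) hmem
  · have hmem : el hfin hm₀ s w a 1 ∈ coefSubmodule (hfin := hfin) (hm₀ := hm₀) hs Q hX hY :=
      h ▸ Submodule.mem_top
    have h' := hmem a hQa
    rw [coef_el_self hfin hm₀ ha] at h'
    exact one_quotient_ne_zero _ h'

/-- The string is cut at its first break `k`. Only one arrow crosses the cut, so the side it points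
to spans a submodule; positions `0` and `k + 1` show that both sides are nonempty. -/
theorem eq_nil_of_isSimpleModule (hs : ω.IsBreak (ω.prev s))
    (h : IsSimpleModule D.Alg (FirstKind ω hfin m₀ hm₀ (ω.jIndex m₀ s) w)) : w = [] := by
  rcases w with _ | ⟨z, w⟩
  · rfl
  exfalso
  obtain ⟨k, hk, hk0, -⟩ := exists_bound hfin hm₀ s 0
  have hk1 : ω.cnt s (k + 1) = 1 := by rw [cnt_succ_of_isBreak hk, hk0]
  have h1 : ω.cnt s (k + 1) ≤ (z :: w).length := hk1.trans_le (by simp)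
  have h0 : ω.cnt s 0 ≤ (z :: w).length := (cnt_zero s).trans_le (Nat.zero_le _)
  have hstep : ∀ a, ω.cnt s a = 0 → ω.cnt s (a + 1) ≠ 0 → ω.IsBreak (ω.seq s a) := by
    intro a ha ha'
    by_contra hb
    exact ha' ((cnt_succ_of_not_isBreak hb).trans ha)
  rcases z with _ | _
  -- First letter `x`: the arrow leaves the first segment, so the vectors vanishing on that segment
  -- form a submodule.
  · refine not_isSimpleModule_of_closed hs (fun a => ω.cnt s a = 0) ?_ ?_ h0 (cnt_zero s) h1
      (by simp [hk1]) h
    · exact fun a _ ha => Nat.eq_zero_of_le_zero ((cnt_mono s a.le_succ).trans_eq ha)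
    · intro a hy ha
      by_contra hb
      have := hy (hstep a ha hb)
      simp [ha] at this
  -- First letter `y`: the arrow enters the first segment, so the vectors supported there form a
  -- submodule.
  · refine not_isSimpleModule_of_closed hs (fun a => ω.cnt s a ≠ 0) ?_ ?_ h1 (by simp [hk1]) h0
      (by simp [cnt_zero]) h
    · intro a hx ha ha'
      have := hx (hstep a ha' ha)
      simp [ha'] at this
    · exact fun a _ ha ha' => ha (Nat.eq_zero_of_le_zero ((cnt_mono s a.le_succ).trans_eq ha'))

end FirstKind

end GWAData

end

theorem theorem5p8 {R : Type*} [CommRing R] [StarRing R] (D : GWAData R)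
    (ω : D.Orbit) (hfin : ω.carrier.Finite) (hreal : ω.IsReal)
    (m₀ : MaximalSpectrum R) (hm₀ : m₀ ∈ ω.breaks)
    (j : ZMod ω.breaks.ncard) (w : GWAData.Word) :
    Nonempty (GWAData.FinDual (GWAData.FirstKind ω hfin m₀ hm₀ j w) ω ≃ₗ[D.Alg]
      GWAData.FirstKind ω hfin m₀ hm₀ j w.sharp) ∧
    (GWAData.IsPseudoUnitarizable (GWAData.FirstKind ω hfin m₀ hm₀ j w) ω ↔ w = []) ∧
    (w = [] ↔ IsSimpleModule D.Alg (GWAData.FirstKind ω hfin m₀ hm₀ j w)) := by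
  -- Replacing `j` by the index of a start that follows a break makes the string coordinates
  -- available.
  obtain ⟨s, hs, rfl⟩ := GWAData.Orbit.exists_start hfin hm₀ j
  refine ⟨(GWAData.FirstKind.nonempty_equiv_finDual hfin hm₀ w hreal hs).map LinearEquiv.symm,
    ⟨GWAData.FirstKind.eq_nil_of_isPseudoUnitarizable hreal hs, ?_⟩,
    ?_, GWAData.FirstKind.eq_nil_of_isSimpleModule hs⟩
  · rintro rfl
    exact GWAData.FirstKind.isPseudoUnitarizable_nil hreal hs
  · rintro rfl
    exact GWAData.FirstKind.isSimpleModule_nil hs
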